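/- A graph is a diagram of finite sets $A \xleftarrow{s} H \xrightarrow{p} V$ with $s$ injective, together with a fixpoint-free involution $i$ on $A$ (arcs, half-edges, vertices). An edge is an $i$-orbit; it is isolated if neither of its arcs is in the image of $s$. A port is an arc outside the image of $s$. A graph is effective if it is nonempty and has no isolated edges. An etale morphism is a triple of maps commuting with $s$, $p$, $i$ whose $p$-square is a pullback. An open subgraph is given by a levelwise injective etale morphism. A reduced cover is an etale morphism that is surjective on edges and vertices and is not so when restricted to any proper open subgraph of its domain. Let $\widetilde{\mathbf{Gr}}$ be the restricted Kleisli category. Its objects are the graphs without isolated edges (the empty graph is allowed). A morphism $R\to Y$ consists of an $i$-equivariant map $A_R\to A_Y$ and, for every vertex $x$ of $R$, an isomorphism class of effective graphs $S_x$ etale over $Y$, with ports labelled by the half-edges $h$ at $x$, the port labelled $h$ lying over the image of $i(s(h))$. Composition is substitution of graphs into vertices. Every etale morphism is regarded as a (free) Kleisli morphism, sending each vertex to its corolla. A Kleisli morphism $R\to Y$ is generic if the graph $S$ obtained by gluing the graphs $S_x$ according to the incidences of $R$ maps isomorphically to $Y$. **Proposition.** Every reduced cover between graphs without isolated edges is an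 epimorphism in $\widetilde{\mathbf{Gr}}$. The classes of reduced covers and of generic morphisms in $\widetilde{\mathbf{Gr}}$ both contain the isomorphisms and are closed under composition, and they admit pushouts along each other, with the resulting new morphisms again a reduced cover and a generic morphism. Hence there is a category $\mathbf{Cosp}$ whose objects are the graphs without isolated edges, whose morphisms $T\to R$ are the isomorphism classes of cospans $T\to S\leftarrow R$ in $\widetilde{\mathbf{Gr}}$ with first leg a reduced cover and second leg a generic morphism, and whose composition is given by pushout. The category $\mathbf{Cosp}$ has a factorisation system whose left class consists of the (classes of) cospans $T\to R = R$ with first leg a reduced cover and second leg an identity, and whose right class consists of the (classes of) cospans $T = T\leftarrow R$ with first leg an identity and second leg a generic morphism. That is, both classes contain the isomorphisms and are closed under composition, every morphism factors as a morphism in the left class followed by a morphism in the right class, and any two such factorisations are related by a unique comparison isomorphism. -/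

import Mathlib

open CategoryTheory

universe u v

/-- A graph: finite sets of arcs `A`, half-edges (flags) `H` and vertices `V`, a fixpoint-free
involution on arcs, an injection `s : H → A` and a map `p : H → V`. -/
structure JKGraph : Type (u + 1) where
  A : Type u
  H : Type u
  V : Type u
  finA : Finite A
  finH : Finite H
  finV : Finite V
  inv : A → A
  s : H → A
  p : H → V
  inv_inv : ∀ a, inv (inv a) = a
  inv_ne : ∀ a, inv a ≠ a
  s_inj : Function.Injective s

namespace JKGraph

/-- A port is an arc not in the image of `s`. -/
def IsPort (G : JKGraph.{u}) (a : G.A) : Prop := a ∉ Set.range G.s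

/-- An arc of an inner edge: the arc and its opposite are both in the image of `s`. -/
def IsInner (G : JKGraph.{u}) (a : G.A) : Prop := a ∈ Set.range G.s ∧ G.inv a ∈ Set.range G.s

/-- No edge is isolated, i.e. every edge contains an arc in the image of `s`. -/
def NoIsolatedEdges (G : JKGraph.{u}) : Prop :=
  ∀ a : G.A, a ∈ Set.range G.s ∨ G.inv a ∈ Set.range G.s

/-- A graph is effective if it is nonempty and has no isolated edges. (Without isolated edges,
a graph is nonempty iff it has a vertex, since every edge is then incident to a vertex.) -/
def Effective (G : JKGraph.{u}) : Prop := Nonempty G.V ∧ G.NoIsolatedEdges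

/-- The half-edges at a vertex. -/
def Flag (G : JKGraph.{u}) (x : G.V) : Type u := {h : G.H // G.p h = x}

end JKGraph

/-- An etale morphism of graphs: levelwise maps commuting with the structure, such that the
square formed by the maps `p` is a pullback. -/
@[ext]
structure Etale (G G' : JKGraph.{u}) : Type u where
  arc : G.A → G'.A
  half : G.H → G'.H
  vert : G.V → G'.V
  arc_inv : ∀ a, arc (G.inv a) = G'.inv (arc a)
  arc_s : ∀ h, arc (G.s h) = G'.s (half h)
  vert_p : ∀ h, vert (G.p h) = G'.p (half h)
  pullback : ∀ (x : G.V) (h' : G'.H), G'.p h' = vert x → ∃! h : G.H, G.p h = x ∧ half h = h'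

namespace Etale

/-- The identity etale morphism. -/
def id (G : JKGraph.{u}) : Etale G G where
  arc a := a
  half h := h
  vert x := x
  arc_inv _ := rfl
  arc_s _ := rfl
  vert_p _ := rfl
  pullback _ h' e := ⟨h', ⟨e, rfl⟩, fun _ y => y.2⟩

/-- Composition of etale morphisms, in diagrammatic order. -/
def comp {G₁ G₂ G₃ : JKGraph.{u}} (f : Etale G₁ G₂) (g : Etale G₂ G₃) : Etale G₁ G₃ where
  arc a := g.arc (f.arc a)
  half h := g.half (f.half h)
  vert x := g.vert (f.vert x)
  arc_inv a := by rw [f.arc_inv, g.arc_inv]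
  arc_s h := by rw [f.arc_s, g.arc_s]
  vert_p h := by rw [f.vert_p, g.vert_p]
  pullback x h' e := by
    obtain ⟨k, ⟨hk, hk'⟩, uk⟩ := g.pullback _ _ e
    obtain ⟨l, ⟨hl, hl'⟩, ul⟩ := f.pullback _ _ hk
    refine ⟨l, ⟨hl, by rw [hl', hk']⟩, fun m hm => ul m ⟨hm.1, uk _ ⟨?_, hm.2⟩⟩⟩
    rw [← f.vert_p, hm.1]

/-- An etale morphism is invertible iff it is levelwise bijective. -/
def IsInvertible {G G' : JKGraph.{u}} (f : Etale G G') : Prop :=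
  Function.Bijective f.arc ∧ Function.Bijective f.half ∧ Function.Bijective f.vert

/-- An etale morphism identifies the half-edges at a vertex with those at the image vertex. -/
noncomputable def flagEquiv {G G' : JKGraph.{u}} (f : Etale G G') (x : G.V) :
    G.Flag x ≃ G'.Flag (f.vert x) :=
  Equiv.ofBijective (fun h => ⟨f.half h.1, by rw [← f.vert_p, h.2]⟩) <| by
    constructor
    · intro h k e
      obtain ⟨l, _, ul⟩ := f.pullback x (f.half h.1) (by rw [← f.vert_p, h.2])
      exact Subtype.ext ((ul _ ⟨h.2, rfl⟩).trans (ul _ ⟨k.2, (congrArg Subtype.val e).symm⟩).symm)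
    · intro h'
      obtain ⟨l, hl, _⟩ := f.pullback x h'.1 h'.2
      exact ⟨⟨l, hl.1⟩, Subtype.ext hl.2⟩

@[simp] theorem flagEquiv_val {G G' : JKGraph.{u}} (f : Etale G G') (x : G.V) (h : G.Flag x) :
    (f.flagEquiv x h).1 = f.half h.1 := rfl

end Etale

/-- An open subgraph of `G`. It is given by a set of arcs stable under the involution, and a set
of vertices; its half-edges are all half-edges at these vertices (so that the inclusion is
etale), whose arcs must belong to the subgraph. -/
structure OpenSubgraph (G : JKGraph.{u}) where
  arcs : Set G.A
  verts : Set G.V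
  inv_mem : ∀ a ∈ arcs, G.inv a ∈ arcs
  s_mem : ∀ h, G.p h ∈ verts → G.s h ∈ arcs

/-- An etale morphism is a reduced cover if it is surjective on edges (equivalently on arcs)
and on vertices, and no proper open subgraph of its domain still has this property. -/
def Etale.IsReducedCover {G G' : JKGraph.{u}} (f : Etale G G') : Prop :=
  Function.Surjective f.arc ∧ Function.Surjective f.vert ∧
    ∀ U : OpenSubgraph G, f.arc '' U.arcs = Set.univ → f.vert '' U.verts = Set.univ →
      U.arcs = Set.univ ∧ U.verts = Set.univ

/-- For a finite set `n`, an effective `n`-graph etale over `Y`: an effective graph, with a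
bijection from `n` to its set of ports, and an etale morphism to `Y`. -/
structure NGraph (n : Type u) (Y : JKGraph.{u}) : Type (u + 1) where
  G : JKGraph.{u}
  eff : G.Effective
  port : n ≃ {a : G.A // G.IsPort a}
  map : Etale G Y

namespace NGraph

/-- Isomorphism of `n`-graphs over `Y`: an isomorphism of graphs that respects the labelling of
the ports and the morphisms to `Y`. -/
def Rel {n : Type u} {Y : JKGraph.{u}} (P Q : NGraph n Y) : Prop :=
  ∃ e : Etale P.G Q.G, e.IsInvertible ∧
    (∀ k, e.arc (P.port k).1 = (Q.port k).1) ∧ e.comp Q.map = P.map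

/-- Relabelling of the ports. -/
def reindex {m n : Type u} {Y : JKGraph.{u}} (e : m ≃ n) (P : NGraph n Y) : NGraph m Y :=
  { P with port := e.trans P.port }

/-- An etale morphism between `n`-graphs that respects port labels and is bijective on vertices
is an isomorphism. -/
theorem isInvertible_of {n : Type u} {Y Z : JKGraph.{u}} (P : NGraph n Y) (Q : NGraph n Z)
    (e : Etale P.G Q.G) (hv : Function.Bijective e.vert)
    (hp : ∀ k, e.arc (P.port k).1 = (Q.port k).1) : e.IsInvertible := by
  have hh : Function.Bijective e.half := by
    constructor
    · intro h k ehk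
      have : P.G.p h = P.G.p k := hv.1 (by rw [e.vert_p, e.vert_p, ehk])
      obtain ⟨l, _, ul⟩ := e.pullback (P.G.p k) (e.half k) (e.vert_p k).symm
      exact (ul h ⟨this, ehk⟩).trans (ul k ⟨rfl, rfl⟩).symm
    · intro h'
      obtain ⟨x, hx⟩ := hv.2 (Q.G.p h')
      obtain ⟨l, hl, _⟩ := e.pullback x h' hx.symm
      exact ⟨l, hl.2⟩
  have key : ∀ a, (∃ h, a = P.G.s h) ∨ ∃ k, a = (P.port k).1 := by
    intro a
    by_cases ha : a ∈ Set.range P.G.s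
    · obtain ⟨h, rfl⟩ := ha; exact Or.inl ⟨h, rfl⟩
    · exact Or.inr ⟨P.port.symm ⟨a, ha⟩, by simp⟩
  refine ⟨⟨?_, ?_⟩, hh, hv⟩
  · intro a b eab
    rcases key a with ⟨h, rfl⟩ | ⟨k, rfl⟩ <;> rcases key b with ⟨h', rfl⟩ | ⟨k', rfl⟩
    · rw [e.arc_s, e.arc_s] at eab
      rw [hh.1 (Q.G.s_inj eab)]
    · rw [e.arc_s, hp] at eab
      exact absurd ⟨_, eab⟩ (Q.port k').2
    · rw [e.arc_s, hp] at eab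
      exact absurd ⟨_, eab.symm⟩ (Q.port k).2
    · rw [hp, hp] at eab
      rw [Q.port.injective (Subtype.ext eab)]
  · intro b
    by_cases hb : b ∈ Set.range Q.G.s
    · obtain ⟨h, rfl⟩ := hb
      obtain ⟨k, rfl⟩ := hh.2 h
      exact ⟨_, e.arc_s k⟩
    · exact ⟨_, (hp (Q.port.symm ⟨b, hb⟩)).trans (by simp)⟩

theorem Rel.refl {n : Type u} {Y : JKGraph.{u}} (P : NGraph n Y) : Rel P P :=
  ⟨Etale.id _, ⟨Function.bijective_id, Function.bijective_id, Function.bijective_id⟩,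
    fun _ => rfl, rfl⟩

theorem Rel.symm {n : Type u} {Y : JKGraph.{u}} {P Q : NGraph n Y} (r : Rel P Q) : Rel Q P := by
  obtain ⟨e, ⟨ha, hh, hv⟩, hp, hm⟩ := r
  let a := Equiv.ofBijective _ ha
  let h := Equiv.ofBijective _ hh
  let x := Equiv.ofBijective _ hv
  have ea : ∀ t, e.arc (a.symm t) = t := a.apply_symm_apply
  have eh : ∀ t, e.half (h.symm t) = t := h.apply_symm_apply
  have ex : ∀ t, e.vert (x.symm t) = t := x.apply_symm_apply
  refine ⟨⟨a.symm, h.symm, x.symm, ?_, ?_, ?_, ?_⟩, ⟨a.symm.bijective, h.symm.bijective,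
    x.symm.bijective⟩, ?_, ?_⟩
  · intro t; apply ha.1; rw [e.arc_inv, ea, ea]
  · intro t; apply ha.1; rw [e.arc_s, ea, eh]
  · intro t; apply hv.1; rw [e.vert_p, ex, eh]
  · intro y k hk
    refine ⟨e.half k, ⟨?_, h.symm_apply_apply k⟩, ?_⟩
    · rw [← e.vert_p, hk, ex]
    · rintro l ⟨_, rfl⟩; rw [eh]
  · intro k; apply ha.1; rw [hp]; exact ea _
  · rw [← hm]
    ext t
    · exact congrArg Q.map.arc (ea t)
    · exact congrArg Q.map.half (eh t)
    · exact congrArg Q.map.vert (ex t)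

theorem Rel.trans {n : Type u} {Y : JKGraph.{u}} {P Q R : NGraph n Y} (r : Rel P Q)
    (r' : Rel Q R) : Rel P R := by
  obtain ⟨e, ⟨ha, hh, hv⟩, hp, hm⟩ := r
  obtain ⟨e', ⟨ha', hh', hv'⟩, hp', hm'⟩ := r'
  refine ⟨e.comp e', ⟨ha'.comp ha, hh'.comp hh, hv'.comp hv⟩, fun k => ?_, ?_⟩
  · exact (congrArg e'.arc (hp k)).trans (hp' k)
  · rw [← hm, ← hm']; rfl

/-- The setoid of isomorphism of `n`-graphs over `Y`. -/
instance setoid (n : Type u) (Y : JKGraph.{u}) : Setoid (NGraph n Y) :=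
  ⟨Rel, Rel.refl, Rel.symm, Rel.trans⟩

theorem Rel.reindex {m n : Type u} {Y : JKGraph.{u}} (e : m ≃ n) {P Q : NGraph n Y}
    (r : Rel P Q) : Rel (P.reindex e) (Q.reindex e) := by
  obtain ⟨f, hf, hp, hm⟩ := r
  exact ⟨f, hf, fun k => hp (e k), hm⟩

end NGraph

/-- The value at the corolla on `n` of the graphical species obtained by applying the monad to
`Y`: the set of isomorphism classes of effective `n`-graphs over `Y`. -/
def NClass (n : Type u) (Y : JKGraph.{u}) : Type (u + 1) := Quotient (NGraph.setoid n Y)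

namespace NClass

/-- The projections of an operation to the colours: the arc of `Y` at the port labelled `k`. -/
def boundary {n : Type u} {Y : JKGraph.{u}} (c : NClass n Y) (k : n) : Y.A :=
  Quotient.lift (fun P : NGraph n Y => P.map.arc (P.port k).1)
    (by
      rintro P Q ⟨e, -, hp, hm⟩
      show P.map.arc _ = Q.map.arc _
      rw [← hm, ← hp]; rfl) c

/-- Relabelling of the ports. -/
def reindex {m n : Type u} {Y : JKGraph.{u}} (e : m ≃ n) (c : NClass n Y) : NClass m Y :=
  Quotient.map (NGraph.reindex e) (fun _ _ r => NGraph.Rel.reindex e r) c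

theorem boundary_out {n : Type u} {Y : JKGraph.{u}} (c : NClass n Y) (k : n) :
    c.out.map.arc (c.out.port k).1 = c.boundary k := by
  conv_rhs => rw [← Quotient.out_eq c]
  rfl

end NClass

/-- A Kleisli morphism from `R` to `Y`, i.e. a morphism of graphical species from `R` to the free
compact coloured prop on `Y`: arcs are sent to arcs (compatibly with the involutions), and every
vertex `x` is sent to an isomorphism class of effective graphs over `Y` whose ports are labelled
by the half-edges at `x`. The half-edge `h` corresponds to the port `i (s h)` of the corolla
at `x`, and the two assignments must agree there. -/
@[ext]
structure KHom (R Y : JKGraph.{u}) : Type (u + 1) where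
  arc : R.A → Y.A
  arc_inv : ∀ a, arc (R.inv a) = Y.inv (arc a)
  sub : ∀ x : R.V, NClass (R.Flag x) Y
  compat : ∀ (x : R.V) (h : R.Flag x), (sub x).boundary h = arc (R.inv (R.s h.1))

namespace JKGraph

variable (G : JKGraph.{u}) {Z : JKGraph.{u}} (K : ∀ x : G.V, NGraph (G.Flag x) Z)

open Classical in
/-- The graph obtained from `G` by substituting, for every vertex `x`, the effective graph `K x`,
whose ports are labelled by the half-edges at `x`. It is the levelwise colimit (gluing) of the
graphs `K x` according to the recipe that assembles `G` from its vertices and edges: the vertices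
and half-edges are those of the graphs `K x`; as no `K x` has isolated edges, every arc is either
an arc of `G` or an arc of an inner edge of a unique `K x`, and an arc `s k` of `K x` opposite to
the port labelled `h` is identified with the arc `s h` of `G`. -/
noncomputable def glue : JKGraph.{u} where
  A := G.A ⊕ (Σ x : G.V, {a : (K x).G.A // (K x).G.IsInner a})
  H := Σ x : G.V, (K x).G.H
  V := Σ x : G.V, (K x).G.V
  finA := by
    have := G.finA; have := G.finV; have := fun x => (K x).G.finA
    infer_instance
  finH := by
    have := G.finV; have := fun x => (K x).G.finH
    infer_instance
  finV := by
    have := G.finV; have := fun x => (K x).G.finV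
    infer_instance
  inv := Sum.map G.inv
    (fun a => ⟨a.1, (K a.1).G.inv a.2.1, a.2.2.2, by rw [inv_inv]; exact a.2.2.1⟩)
  s k := if hk : (K k.1).G.IsPort ((K k.1).G.inv ((K k.1).G.s k.2)) then
      Sum.inl (G.s ((K k.1).port.symm ⟨_, hk⟩).1)
    else Sum.inr ⟨k.1, (K k.1).G.s k.2, ⟨_, rfl⟩, not_not.1 hk⟩
  p k := ⟨k.1, (K k.1).G.p k.2⟩
  inv_inv := by
    rintro (a | ⟨x, a, ha⟩)
    · simp [inv_inv]
    · simp [inv_inv]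
  inv_ne := by
    rintro (a | ⟨x, a, ha⟩) e
    · exact G.inv_ne a (Sum.inl.inj e)
    · exact (K x).G.inv_ne a
        (congrArg Subtype.val (eq_of_heq (Sigma.mk.inj (Sum.inr.inj e)).2))
  s_inj := by
    rintro ⟨x, k⟩ ⟨y, l⟩ e
    dsimp only at e
    split_ifs at e with h1 h2 h2
    · have e1 := G.s_inj (Sum.inl.inj e)
      obtain rfl : x = y := by
        rw [← ((K x).port.symm ⟨_, h1⟩).2, ← ((K y).port.symm ⟨_, h2⟩).2, e1]
      have e2 := congrArg Subtype.val ((K x).port.symm.injective (Subtype.ext e1))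
      have e3 := congrArg (K x).G.inv e2
      simp only [inv_inv] at e3
      rw [(K x).G.s_inj e3]
    · have := Sum.inr.inj e
      obtain ⟨rfl, e⟩ := Sigma.mk.inj this
      have := congrArg Subtype.val (eq_of_heq e)
      rw [(K x).G.s_inj this]

variable {G K}

theorem glue_s_port (x : G.V) (k : (K x).G.H) (h : G.Flag x)
    (e : (K x).G.inv ((K x).G.s k) = ((K x).port h).1) :
    (G.glue K).s ⟨x, k⟩ = Sum.inl (G.s h.1) := by
  have hp : (K x).G.IsPort ((K x).G.inv ((K x).G.s k)) := by rw [e]; exact ((K x).port h).2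
  have : (K x).port.symm ⟨_, hp⟩ = h := by
    rw [Equiv.symm_apply_eq]; exact Subtype.ext e
  simp only [glue, dif_pos hp, this]

theorem glue_s_inner (x : G.V) (k : (K x).G.H)
    (e : (K x).G.inv ((K x).G.s k) ∈ Set.range (K x).G.s) :
    (G.glue K).s ⟨x, k⟩ = Sum.inr ⟨x, (K x).G.s k, ⟨_, rfl⟩, e⟩ := by
  have hp : ¬ (K x).G.IsPort ((K x).G.inv ((K x).G.s k)) := not_not.2 e
  simp only [glue, dif_neg hp]

theorem half_cases (x : G.V) (k : (K x).G.H) :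
    (∃ h : G.Flag x, (K x).G.inv ((K x).G.s k) = ((K x).port h).1) ∨
      (K x).G.inv ((K x).G.s k) ∈ Set.range (K x).G.s := by
  by_cases hp : (K x).G.inv ((K x).G.s k) ∈ Set.range (K x).G.s
  · exact Or.inr hp
  · exact Or.inl ⟨(K x).port.symm ⟨_, hp⟩, by simp⟩

/-- Every half-edge `h` of `G` gives a half-edge of the glued graph. -/
theorem exists_half (h : G.H) :
    ∃ k : (K (G.p h)).G.H, (K (G.p h)).G.s k =
      (K (G.p h)).G.inv ((K (G.p h)).port ⟨h, rfl⟩).1 := by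
  rcases (K (G.p h)).eff.2 ((K (G.p h)).port ⟨h, rfl⟩).1 with hk | ⟨k, hk⟩
  · exact absurd hk ((K (G.p h)).port ⟨h, rfl⟩).2
  · exact ⟨k, hk⟩

theorem glue_inl_mem (h : G.H) : (Sum.inl (G.s h) : (G.glue K).A) ∈ Set.range (G.glue K).s := by
  obtain ⟨k, hk⟩ := exists_half (K := K) h
  exact ⟨⟨G.p h, k⟩, glue_s_port _ _ ⟨h, rfl⟩ (by rw [hk, inv_inv])⟩

theorem glue_inl_isPort (a : G.A) : (G.glue K).IsPort (Sum.inl a) ↔ G.IsPort a := by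
  constructor
  · rintro h ⟨k, rfl⟩
    exact h (glue_inl_mem k)
  · rintro h ⟨⟨x, k⟩, e⟩
    rcases half_cases x k with ⟨l, hl⟩ | hl
    · rw [glue_s_port x k l hl] at e
      exact h ⟨_, Sum.inl.inj e⟩
    · rw [glue_s_inner x k hl] at e
      cases e

theorem glue_inr_mem (a : Σ x : G.V, {a : (K x).G.A // (K x).G.IsInner a}) :
    (Sum.inr a : (G.glue K).A) ∈ Set.range (G.glue K).s := by
  obtain ⟨x, a, ⟨k, rfl⟩, ha⟩ := a
  exact ⟨⟨x, k⟩, glue_s_inner x k ha⟩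

variable (G K) in
/-- The ports of the glued graph are the ports of `G`. -/
def gluePort : {a : G.A // G.IsPort a} ≃ {a : (G.glue K).A // (G.glue K).IsPort a} where
  toFun a := ⟨Sum.inl a.1, (glue_inl_isPort a.1).2 a.2⟩
  invFun
    | ⟨Sum.inl a, ha⟩ => ⟨a, (glue_inl_isPort a).1 ha⟩
    | ⟨Sum.inr a, ha⟩ => absurd (glue_inr_mem a) ha
  left_inv _ := rfl
  right_inv
    | ⟨Sum.inl _, _⟩ => rfl
    | ⟨Sum.inr a, ha⟩ => absurd (glue_inr_mem a) ha

theorem glue_noIsolatedEdges (hG : G.NoIsolatedEdges) : (G.glue K).NoIsolatedEdges := by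
  rintro (a | a)
  · rcases hG a with ⟨h, rfl⟩ | ⟨h, e⟩
    · exact Or.inl (glue_inl_mem h)
    · right
      have := glue_inl_mem (K := K) h
      rwa [e] at this
  · exact Or.inl (glue_inr_mem a)

theorem glue_effective (hG : G.Effective) : (G.glue K).Effective := by
  refine ⟨?_, glue_noIsolatedEdges hG.2⟩
  obtain ⟨x⟩ := hG.1
  obtain ⟨y⟩ := (K x).eff.1
  exact ⟨⟨x, y⟩⟩

variable (G K) in
/-- A map `α` on arcs that agrees with the graphs `K x` over `Z` at their ports induces an etale
morphism from the glued graph to `Z`. -/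
noncomputable def glueMap (α : G.A → Z.A) (hα : ∀ a, α (G.inv a) = Z.inv (α a))
    (hK : ∀ (x : G.V) (h : G.Flag x), (K x).map.arc ((K x).port h).1 = α (G.inv (G.s h.1))) :
    Etale (G.glue K) Z where
  arc := Sum.elim α (fun a => (K a.1).map.arc a.2.1)
  half k := (K k.1).map.half k.2
  vert y := (K y.1).map.vert y.2
  arc_inv := by
    rintro (a | ⟨x, a⟩)
    · exact hα a
    · exact (K x).map.arc_inv _
  arc_s := by
    rintro ⟨x, k⟩
    rcases half_cases x k with ⟨l, hl⟩ | hl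
    · rw [glue_s_port x k l hl]
      have := hK x l
      rw [← hl, Etale.arc_inv, Etale.arc_s, hα] at this
      have := congrArg Z.inv this
      rw [Z.inv_inv, Z.inv_inv] at this
      exact this.symm
    · rw [glue_s_inner x k hl]
      exact (K x).map.arc_s _
  vert_p k := (K k.1).map.vert_p k.2
  pullback := by
    rintro ⟨x, y⟩ h' e
    obtain ⟨k, ⟨hk, hk'⟩, u⟩ := (K x).map.pullback y h' e
    refine ⟨⟨x, k⟩, ⟨congrArg (Sigma.mk x) hk, hk'⟩, ?_⟩
    rintro ⟨x', l⟩ ⟨hl, hl'⟩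
    obtain ⟨rfl, hl⟩ := Sigma.mk.inj hl
    rw [u l ⟨eq_of_heq hl, hl'⟩]

/-- An etale morphism `e : G → G'` together with isomorphisms `K x ≅ K' (e x)` induces an etale
morphism of glued graphs. -/
theorem exists_glueHom {G' : JKGraph.{u}} {K' : ∀ x : G'.V, NGraph (G'.Flag x) Z}
    (e : Etale G G')
    (θ : ∀ x, NGraph.Rel (K x) ((K' (e.vert x)).reindex (e.flagEquiv x))) :
    ∃ F : Etale (G.glue K) (G'.glue K'),
      (∀ a, F.arc (Sum.inl a) = Sum.inl (e.arc a)) ∧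
      (Function.Bijective e.vert → Function.Bijective F.vert) ∧
      ∀ α hα hK α' hα' hK', (∀ a, α' (e.arc a) = α a) →
        F.comp (G'.glueMap K' α' hα' hK') = G.glueMap K α hα hK := by
  choose t ht hp hm using θ
  have inner : ∀ x a, (K x).G.IsInner a → (K' (e.vert x)).G.IsInner ((t x).arc a) := by
    rintro x a ⟨⟨k, rfl⟩, ⟨l, hl⟩⟩
    exact ⟨⟨_, ((t x).arc_s k).symm⟩, ⟨(t x).half l,
      ((t x).arc_s l).symm.trans ((congrArg _ hl).trans ((t x).arc_inv _))⟩⟩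
  refine ⟨⟨Sum.map e.arc (fun a => ⟨e.vert a.1, (t a.1).arc a.2.1, inner _ _ a.2.2⟩),
    fun k => ⟨e.vert k.1, (t k.1).half k.2⟩, fun y => ⟨e.vert y.1, (t y.1).vert y.2⟩,
    ?_, ?_, ?_, ?_⟩, ?_, ?_, ?_⟩
  · rintro (a | ⟨x, a, ha⟩)
    · exact congrArg Sum.inl (e.arc_inv a)
    · refine congrArg Sum.inr (congrArg (Sigma.mk (e.vert x)) (Subtype.ext ?_))
      exact (t x).arc_inv a
  · rintro ⟨x, k⟩
    rcases half_cases x k with ⟨l, hl⟩ | hl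
    · rw [glue_s_port x k l hl, glue_s_port (K := K') (e.vert x) ((t x).half k)
        (e.flagEquiv x l)]
      · exact congrArg Sum.inl (e.arc_s _)
      · have h1 := (t x).arc_s k
        have h2 := (t x).arc_inv ((K x).G.s k)
        have h3 := hp x l
        rw [← hl, h2, h1] at h3
        exact h3
    · have hl' : (K' (e.vert x)).G.inv ((K' (e.vert x)).G.s ((t x).half k)) ∈
          Set.range (K' (e.vert x)).G.s := by
        have h1 := (t x).arc_s k
        have := (inner x _ ⟨⟨k, rfl⟩, hl⟩).2
        rw [h1] at this; exact this
      rw [glue_s_inner x k hl, glue_s_inner (K := K') _ _ hl']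
      refine congrArg Sum.inr (congrArg (Sigma.mk (e.vert x)) (Subtype.ext ?_))
      exact (t x).arc_s k
  · rintro ⟨x, k⟩
    exact congrArg (Sigma.mk (e.vert x)) ((t x).vert_p k)
  · rintro ⟨x, y⟩ ⟨x', h'⟩ eq
    obtain ⟨rfl, eq⟩ := Sigma.mk.inj eq
    obtain ⟨k, ⟨hk, hk'⟩, w⟩ := (t x).pullback y h' (eq_of_heq eq)
    refine ⟨⟨x, k⟩, ⟨congrArg (Sigma.mk x) hk, congrArg (Sigma.mk _) hk'⟩, ?_⟩
    rintro ⟨x', l⟩ ⟨hl, hl'⟩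
    obtain ⟨rfl, hl⟩ := Sigma.mk.inj hl
    have hl' := eq_of_heq (Sigma.mk.inj hl').2
    rw [w l ⟨eq_of_heq hl, hl'⟩]
  · intro a; rfl
  · intro hv
    constructor
    · rintro ⟨x, y⟩ ⟨x', y'⟩ eq
      have h1 := hv.1 (Sigma.mk.inj eq).1
      dsimp only at h1
      subst h1
      exact congrArg (Sigma.mk x) ((ht x).2.2.1 (eq_of_heq (Sigma.mk.inj eq).2))
    · rintro ⟨x', y'⟩
      obtain ⟨x, rfl⟩ := hv.2 x'
      obtain ⟨y, hy⟩ := (ht x).2.2.2 y'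
      exact ⟨⟨x, y⟩, congrArg (Sigma.mk _) hy⟩
  · intro α hα hK α' hα' hK' hh
    ext z
    · rcases z with a | ⟨x, a⟩
      · exact hh a
      · exact congrArg (fun f => f.arc a.1) (hm x)
    · exact congrArg (fun f => f.half z.2) (hm z.1)
    · exact congrArg (fun f => f.vert z.2) (hm z.1)

end JKGraph

namespace NGraph

/-- Substitution of the graphs `K x` over `Z` into the vertices of an `n`-graph `P`. -/
noncomputable def subst {n : Type u} {Y Z : JKGraph.{u}} (P : NGraph n Y)
    (K : ∀ x : P.G.V, NGraph (P.G.Flag x) Z) (α : P.G.A → Z.A)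
    (hα : ∀ a, α (P.G.inv a) = Z.inv (α a))
    (hK : ∀ (x : P.G.V) (h : P.G.Flag x),
      (K x).map.arc ((K x).port h).1 = α (P.G.inv (P.G.s h.1))) : NGraph n Z where
  G := P.G.glue K
  eff := JKGraph.glue_effective P.eff
  port := P.port.trans (P.G.gluePort K)
  map := P.G.glueMap K α hα hK

theorem subst_rel {n : Type u} {Y Z : JKGraph.{u}} {P P' : NGraph n Y} {K K' α hα hK α' hα' hK'}
    (e : Etale P.G P'.G) (he : Function.Bijective e.vert)
    (hp : ∀ k, e.arc (P.port k).1 = (P'.port k).1)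
    (θ : ∀ x, Rel (K x) ((K' (e.vert x)).reindex (e.flagEquiv x)))
    (hh : ∀ a, α' (e.arc a) = α a) :
    Rel (P.subst (Z := Z) K α hα hK) (P'.subst K' α' hα' hK') := by
  obtain ⟨F, h1, h2, h3⟩ := JKGraph.exists_glueHom e θ
  have hp' : ∀ k, F.arc ((P.subst K α hα hK).port k).1 = ((P'.subst K' α' hα' hK').port k).1 :=
    fun k => (h1 _).trans (congrArg Sum.inl (hp k))
  exact ⟨F, isInvertible_of (P.subst K α hα hK) (P'.subst K' α' hα' hK') F (h2 he) hp', hp',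
    h3 α hα hK α' hα' hK' hh⟩

/-- The graphs to be substituted in `P` in order to compose with the Kleisli morphism `ψ`. -/
noncomputable def family {n : Type u} {Y Z : JKGraph.{u}} (P : NGraph n Y) (ψ : KHom Y Z)
    (x : P.G.V) : NGraph (P.G.Flag x) Z :=
  (ψ.sub (P.map.vert x)).out.reindex (P.map.flagEquiv x)

/-- The action of a Kleisli morphism `Y → Z` on `n`-graphs over `Y`: every vertex is substituted
by the graph assigned to its image in `Y`. -/
noncomputable def bind {n : Type u} {Y Z : JKGraph.{u}} (P : NGraph n Y) (ψ : KHom Y Z) :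
    NGraph n Z :=
  P.subst (P.family ψ) (fun a => ψ.arc (P.map.arc a))
    (fun a => by rw [P.map.arc_inv, ψ.arc_inv]) (fun x h => by
      refine (NClass.boundary_out _ _).trans ((ψ.compat _ _).trans ?_)
      rw [Etale.flagEquiv_val, P.map.arc_inv, P.map.arc_s])

theorem bind_rel {n : Type u} {Y Z : JKGraph.{u}} {P Q : NGraph n Y} (r : Rel P Q)
    (ψ : KHom Y Z) : Rel (P.bind ψ) (Q.bind ψ) := by
  obtain ⟨e, he, hp, hm⟩ := r
  obtain ⟨G, eff, port, map⟩ := P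
  dsimp only at e hm hp he
  subst hm
  exact subst_rel e he.2.2 hp (fun x => Rel.refl _) (fun a => rfl)

end NGraph

/-- The action of a Kleisli morphism on isomorphism classes of `n`-graphs. -/
noncomputable def NClass.bind {n : Type u} {Y Z : JKGraph.{u}} (c : NClass n Y) (ψ : KHom Y Z) :
    NClass n Z :=
  Quotient.map (fun P : NGraph n Y => P.bind ψ) (fun _ _ r => NGraph.bind_rel r ψ) c

namespace KHom

/-- Composition of Kleisli morphisms, in diagrammatic order. -/
noncomputable def comp {X Y Z : JKGraph.{u}} (φ : KHom X Y) (ψ : KHom Y Z) : KHom X Z where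
  arc a := ψ.arc (φ.arc a)
  arc_inv a := by rw [φ.arc_inv, ψ.arc_inv]
  sub x := (φ.sub x).bind ψ
  compat x h := by
    rw [← φ.compat]
    generalize φ.sub x = c
    induction c using Quotient.inductionOn
    rfl

end KHom

namespace JKGraph

/-- The corolla of `G` at a vertex `x`: one vertex, with half-edges the half-edges of `G` at `x`,
and one port opposite to every half-edge. -/
def corolla (G : JKGraph.{u}) (x : G.V) : JKGraph.{u} where
  A := G.Flag x ⊕ G.Flag x
  H := G.Flag x
  V := PUnit
  finA := by
    have : Finite (G.Flag x) := by have := G.finH; exact inferInstanceAs (Finite {h // _})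
    infer_instance
  finH := by have := G.finH; exact inferInstanceAs (Finite {h // _})
  finV := inferInstance
  inv := Sum.swap
  s := Sum.inl
  p _ := PUnit.unit
  inv_inv := Sum.swap_swap
  inv_ne := by rintro (a | a) e <;> cases e
  s_inj := Sum.inl_injective

/-- The canonical etale morphism from the corolla at `x`. -/
def corollaMap (G : JKGraph.{u}) (x : G.V) : Etale (G.corolla x) G where
  arc := Sum.elim (fun h => G.s h.1) (fun h => G.inv (G.s h.1))
  half h := h.1
  vert _ := x
  arc_inv := by
    rintro (h | h)
    · rfl
    · exact (G.inv_inv _).symm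
  arc_s _ := rfl
  vert_p h := h.2.symm
  pullback _ h' e := ⟨⟨h', e⟩, ⟨rfl, rfl⟩, fun _ y => Subtype.ext y.2⟩

end JKGraph

/-- The corolla at a vertex `x` of `G`, over `G'` by means of an etale morphism `f : G → G'`,
with its ports labelled by the opposite half-edges. -/
def NGraph.corolla {G G' : JKGraph.{u}} (f : Etale G G') (x : G.V) : NGraph (G.Flag x) G' where
  G := G.corolla x
  eff := by
    refine ⟨⟨PUnit.unit⟩, ?_⟩
    rintro (h | h)
    · exact Or.inl ⟨h, rfl⟩
    · exact Or.inr ⟨h, rfl⟩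
  port :=
    { toFun := fun h => ⟨Sum.inr h, by rintro ⟨k, e⟩; cases e⟩
      invFun := fun
        | ⟨Sum.inl h, e⟩ => absurd ⟨h, rfl⟩ e
        | ⟨Sum.inr h, _⟩ => h
      left_inv := fun _ => rfl
      right_inv := fun
        | ⟨Sum.inl h, e⟩ => absurd ⟨h, rfl⟩ e
        | ⟨Sum.inr _, _⟩ => rfl }
  map := (G.corollaMap x).comp f

namespace KHom

/-- The free Kleisli morphism on an etale morphism: every vertex is sent to its corolla. -/
def free {G G' : JKGraph.{u}} (f : Etale G G') : KHom G G' where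
  arc := f.arc
  arc_inv := f.arc_inv
  sub x := Quotient.mk _ (NGraph.corolla f x)
  compat _ _ := rfl

/-- The identity Kleisli morphism (the unit of the monad). -/
def id (G : JKGraph.{u}) : KHom G G := free (Etale.id G)

end KHom

namespace NGraph

theorem bind_corolla {X Y Z : JKGraph.{u}} (f : Etale X Y) (ψ : KHom Y Z) (x : X.V) :
    Rel ((corolla f x).bind ψ) ((ψ.sub (f.vert x)).out.reindex (f.flagEquiv x)) := by
  let Q := (ψ.sub (f.vert x)).out.reindex (f.flagEquiv x)
  let K := (corolla f x).family ψ
  have hK : ∀ h : (corolla f x).G.Flag PUnit.unit,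
      ((K PUnit.unit).port h).1 = (Q.port h.1).1 := fun h => by
    have : (corolla f x).map.flagEquiv PUnit.unit h = f.flagEquiv x h.1 := Subtype.ext rfl
    show ((ψ.sub (f.vert x)).out.port _).1 = ((ψ.sub (f.vert x)).out.port _).1
    rw [this]
  have bQ : ∀ h, Q.map.arc (Q.port h).1 = ψ.arc (f.arc (X.inv (X.s h.1))) := fun h => by
    refine (NClass.boundary_out _ _).trans ((ψ.compat _ _).trans ?_)
    rw [Etale.flagEquiv_val, f.arc_inv, f.arc_s]
  let F : Etale ((corolla f x).bind ψ).G Q.G :=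
    { arc := Sum.elim (Sum.elim (fun h => Q.G.inv (Q.port h).1) (fun h => (Q.port h).1))
        (fun a => a.2.1)
      half := fun k => k.2
      vert := fun y => y.2
      arc_inv := by
        rintro ((h | h) | ⟨_, a, ha⟩)
        · exact (Q.G.inv_inv _).symm
        · rfl
        · rfl
      arc_s := by
        rintro ⟨⟨⟩, k⟩
        rcases JKGraph.half_cases (K := K) PUnit.unit k with ⟨h, hl⟩ | hl
        · have := JKGraph.glue_s_port (K := K) PUnit.unit k h hl
          refine (congrArg _ this).trans ?_
          show Q.G.inv (Q.port h.1).1 = Q.G.s k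
          rw [← hK h, ← hl]
          exact Q.G.inv_inv _
        · have := JKGraph.glue_s_inner (K := K) PUnit.unit k hl
          exact (congrArg _ this).trans rfl
      vert_p := fun _ => rfl
      pullback := by
        rintro ⟨⟨⟩, y⟩ h' e
        refine ⟨⟨PUnit.unit, h'⟩, ⟨congrArg (Sigma.mk PUnit.unit) e, rfl⟩, ?_⟩
        rintro ⟨⟨⟩, k⟩ ⟨_, rfl⟩
        rfl }
  have hp : ∀ k, F.arc (((corolla f x).bind ψ).port k).1 = (Q.port k).1 := fun k => rfl
  refine ⟨F, isInvertible_of _ _ F ⟨?_, fun y => ⟨⟨PUnit.unit, y⟩, rfl⟩⟩ hp, hp, ?_⟩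
  · rintro ⟨⟨⟩, y⟩ ⟨⟨⟩, y'⟩ (rfl : y = y')
    rfl
  · ext z
    · rcases z with (h | h) | ⟨⟨⟩, a⟩
      · show Q.map.arc (Q.G.inv (Q.port h).1) = ψ.arc (f.arc (X.s h.1))
        rw [Q.map.arc_inv, bQ, f.arc_inv, ψ.arc_inv, Z.inv_inv]
      · exact bQ h
      · rfl
    · rfl
    · rfl

/-- In a composite, the chosen representatives of the isomorphism classes of graphs to be
substituted can be replaced by any others. -/
theorem bind_rel_subst {n : Type u} {Y Z : JKGraph.{u}} (P : NGraph n Y) (ψ : KHom Y Z)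
    (K : ∀ x : P.G.V, NGraph (P.G.Flag x) Z) (hK) (θ : ∀ x, Rel (P.family ψ x) (K x)) :
    Rel (P.bind ψ) (P.subst K (fun a => ψ.arc (P.map.arc a))
      (fun a => by rw [P.map.arc_inv, ψ.arc_inv]) hK) :=
  subst_rel (Etale.id _) Function.bijective_id (fun _ => rfl) θ (fun _ => rfl)

theorem bind_id {n : Type u} {Y : JKGraph.{u}} (P : NGraph n Y) : Rel (P.bind (KHom.id Y)) P := by
  let K := fun x : P.G.V =>
    (corolla (Etale.id Y) (P.map.vert x)).reindex (P.map.flagEquiv x)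
  have hK : ∀ (x : P.G.V) (h : P.G.Flag x), (K x).map.arc ((K x).port h).1 =
      P.map.arc (P.G.inv (P.G.s h.1)) := fun x h => by
    rw [P.map.arc_inv, P.map.arc_s]; rfl
  refine Rel.trans (bind_rel_subst P (KHom.id Y) K hK fun x =>
    Rel.reindex _ (Quotient.exact (s := setoid _ _) (Quotient.out_eq _))) ?_
  have no : ∀ (x : P.G.V) (a : {a // (K x).G.IsInner a}), False := by
    rintro x ⟨h | h, h1, h2⟩
    · obtain ⟨_, h2⟩ := h2; cases h2
    · obtain ⟨_, h1⟩ := h1; cases h1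
  let R := P.subst K (fun a => (KHom.id Y).arc (P.map.arc a))
      (fun a => by rw [P.map.arc_inv, (KHom.id Y).arc_inv]) hK
  let F : Etale R.G P.G :=
    { arc := Sum.elim (fun a => a) (fun a => (no _ a.2).elim)
      half := fun k => ((P.map.flagEquiv k.1).symm k.2).1
      vert := fun y => y.1
      arc_inv := by
        rintro (a | ⟨x, a⟩)
        · rfl
        · exact (no _ a).elim
      arc_s := by
        rintro ⟨x, k⟩
        refine (congrArg _ (JKGraph.glue_s_port (K := K) x k ((P.map.flagEquiv x).symm k) ?_)).trans
          rfl
        exact congrArg Sum.inr ((P.map.flagEquiv x).apply_symm_apply k).symm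
      vert_p := fun k => ((P.map.flagEquiv k.1).symm k.2).2.symm
      pullback := by
        rintro ⟨x, ⟨⟩⟩ h' e
        refine ⟨⟨x, P.map.flagEquiv x ⟨h', e⟩⟩, ⟨rfl, ?_⟩, ?_⟩
        · exact congrArg Subtype.val ((P.map.flagEquiv x).symm_apply_apply ⟨h', e⟩)
        · rintro ⟨x', k⟩ ⟨hk, rfl⟩
          obtain ⟨rfl, _⟩ := Sigma.mk.inj hk
          exact congrArg (Sigma.mk x') ((P.map.flagEquiv x').apply_symm_apply k).symm }
  have hp : ∀ k, F.arc (R.port k).1 = (P.port k).1 := fun k => rfl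
  refine ⟨F, isInvertible_of R P F ⟨?_, fun y => ⟨⟨y, PUnit.unit⟩, rfl⟩⟩ hp, hp, ?_⟩
  · rintro ⟨x, ⟨⟩⟩ ⟨x', ⟨⟩⟩ (rfl : x = x')
    rfl
  · ext z
    · rcases z with a | ⟨x, a⟩
      · rfl
      · exact (no _ a).elim
    · exact congrArg Subtype.val ((P.map.flagEquiv z.1).apply_symm_apply z.2)
    · rfl

theorem bind_bind {n : Type u} {X Y Z : JKGraph.{u}} (P : NGraph n X) (ψ : KHom X Y)
    (χ : KHom Y Z) : Rel ((P.bind ψ).bind χ) (P.bind (ψ.comp χ)) := by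
  let K := P.family ψ
  let M := fun x : P.G.V => (K x).bind χ
  have hM : ∀ (x : P.G.V) (h : P.G.Flag x), (M x).map.arc ((M x).port h).1 =
      χ.arc (ψ.arc (P.map.arc (P.G.inv (P.G.s h.1)))) := fun x h => by
    refine congrArg χ.arc ((NClass.boundary_out _ _).trans ((ψ.compat _ _).trans ?_))
    rw [Etale.flagEquiv_val, P.map.arc_inv, P.map.arc_s]
  refine Rel.trans ?_ (Rel.symm (bind_rel_subst P (ψ.comp χ) M hM fun x =>
    Rel.reindex (P.map.flagEquiv x) (Quotient.exact (s := setoid _ _) ((Quotient.out_eq _).trans ?_))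
      (Q := (ψ.sub (P.map.vert x)).out.bind χ)))
  swap
  · show NClass.bind (ψ.sub _) χ = _
    conv_lhs => rw [← Quotient.out_eq (ψ.sub (P.map.vert x))]
    rfl
  let L := (P.bind ψ).family χ
  let R := P.subst M (fun a => (ψ.comp χ).arc (P.map.arc a))
      (fun a => by rw [P.map.arc_inv, (ψ.comp χ).arc_inv]) hM
  let F : Etale ((P.bind ψ).bind χ).G R.G :=
    { arc := Sum.elim
        (Sum.elim Sum.inl (fun a => Sum.inr ⟨a.1, Sum.inl a.2.1, by
          obtain ⟨x, a, ⟨k, rfl⟩, l, hl⟩ := a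
          refine ⟨JKGraph.glue_inl_mem k, ?_⟩
          have := JKGraph.glue_inl_mem (G := (K x).G) (K := (K x).family χ) l
          rw [hl] at this
          exact this⟩))
        (fun b => Sum.inr ⟨b.1.1, Sum.inr ⟨b.1.2, b.2⟩,
          JKGraph.glue_inr_mem (G := (K b.1.1).G) (K := (K b.1.1).family χ) _,
          JKGraph.glue_inr_mem (G := (K b.1.1).G) (K := (K b.1.1).family χ) _⟩)
      half := fun l => ⟨l.1.1, l.1.2, l.2⟩
      vert := fun z => ⟨z.1.1, z.1.2, z.2⟩
      arc_inv := by rintro ((a | a) | b) <;> rfl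
      arc_s := by
        rintro ⟨⟨x, y⟩, l⟩
        rcases JKGraph.half_cases (K := L) (⟨x, y⟩ : (P.bind ψ).G.V) l with ⟨⟨⟨x', k⟩, h⟩, hl⟩ | hl
        · refine (congrArg _ (JKGraph.glue_s_port (K := L) _ l _ hl)).trans ?_
          obtain ⟨rfl, h'⟩ := Sigma.mk.inj h
          have h' := eq_of_heq h'
          subst h'
          have e2 : ((K x').family χ ((K x').G.p k)).G.inv (((K x').family χ ((K x').G.p k)).G.s l)
              = (((K x').family χ ((K x').G.p k)).port ⟨k, rfl⟩).1 := hl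
          have e3 := JKGraph.glue_s_port (K := (K x').family χ) _ l _ e2
          rcases JKGraph.half_cases (K := K) x' k with ⟨h2, hk⟩ | hk
          · refine (congrArg _ (congrArg Sum.inl (JKGraph.glue_s_port (K := K) x' k h2 hk))).trans ?_
            refine Eq.trans ?_ (JKGraph.glue_s_port (K := M) x' ⟨(K x').G.p k, l⟩ h2 ?_).symm
            · rfl
            · refine (congrArg ((M x').G.inv) e3).trans ?_
              exact congrArg Sum.inl hk
          · refine (congrArg _ (congrArg Sum.inl (JKGraph.glue_s_inner (K := K) x' k hk))).trans ?_
            have hk2 : (M x').G.inv ((M x').G.s ⟨(K x').G.p k, l⟩) ∈ Set.range (M x').G.s := by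
              obtain ⟨m, hm⟩ := hk
              have := JKGraph.glue_inl_mem (G := (K x').G) (K := (K x').family χ) m
              rw [hm] at this
              have e4 := congrArg ((M x').G.inv) e3
              exact e4 ▸ this
            refine Eq.trans ?_ (JKGraph.glue_s_inner (K := M) x' ⟨(K x').G.p k, l⟩ hk2).symm
            exact congrArg Sum.inr (congrArg (Sigma.mk x') (Subtype.ext e3.symm))
        · refine (congrArg _ (JKGraph.glue_s_inner (K := L) _ l hl)).trans ?_
          have e3 := JKGraph.glue_s_inner (K := (K x).family χ) y l hl
          have hk2 : (M x).G.inv ((M x).G.s ⟨y, l⟩) ∈ Set.range (M x).G.s := by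
            have e4 := congrArg ((M x).G.inv) e3
            exact e4 ▸ JKGraph.glue_inr_mem (G := (K x).G) (K := (K x).family χ) _
          refine Eq.trans ?_ (JKGraph.glue_s_inner (K := M) x ⟨y, l⟩ hk2).symm
          exact congrArg Sum.inr (congrArg (Sigma.mk x) (Subtype.ext e3.symm))
      vert_p := fun _ => rfl
      pullback := by
        rintro ⟨⟨x, y⟩, z⟩ ⟨x', y', l⟩ e
        obtain ⟨rfl, e⟩ := Sigma.mk.inj e
        obtain ⟨rfl, e⟩ := Sigma.mk.inj (eq_of_heq e)
        refine ⟨⟨⟨x', y'⟩, l⟩, ⟨congrArg (Sigma.mk _) (eq_of_heq e), rfl⟩, ?_⟩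
        rintro ⟨⟨x, y⟩, k⟩ ⟨_, h⟩
        obtain ⟨rfl, h⟩ := Sigma.mk.inj h
        obtain ⟨rfl, h⟩ := Sigma.mk.inj (eq_of_heq h)
        exact congrArg (Sigma.mk _) (eq_of_heq h) }
  have hp : ∀ k, F.arc (((P.bind ψ).bind χ).port k).1 = (R.port k).1 := fun k => rfl
  refine ⟨F, isInvertible_of _ R F ⟨?_, fun z => ⟨⟨⟨z.1, z.2.1⟩, z.2.2⟩, rfl⟩⟩ hp, hp, ?_⟩
  · rintro ⟨⟨x, y⟩, z⟩ ⟨⟨x', y'⟩, z'⟩ h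
    obtain ⟨rfl, h⟩ := Sigma.mk.inj h
    obtain ⟨rfl, h⟩ := Sigma.mk.inj (eq_of_heq h)
    exact congrArg (Sigma.mk _) (eq_of_heq h)
  · ext z
    · rcases z with (a | a) | b <;> rfl
    · rfl
    · rfl

end NGraph

namespace KHom

theorem id_comp {X Y : JKGraph.{u}} (φ : KHom X Y) : (KHom.id X).comp φ = φ := by
  ext x
  · rfl
  · refine (Quotient.sound (NGraph.bind_corolla (Etale.id X) φ x)).trans ?_
    have : (φ.sub x).out.reindex ((Etale.id X).flagEquiv x) = (φ.sub x).out := by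
      have : (Etale.id X).flagEquiv x = Equiv.refl (X.Flag x) := Equiv.ext fun _ => rfl
      rw [this]; rfl
    exact (congrArg (Quotient.mk _) this).trans (Quotient.out_eq _)

theorem comp_id {X Y : JKGraph.{u}} (φ : KHom X Y) : φ.comp (KHom.id Y) = φ := by
  ext x
  · rfl
  · show NClass.bind (φ.sub x) (KHom.id Y) = φ.sub x
    generalize φ.sub x = c
    induction c using Quotient.inductionOn with
    | h P => exact Quotient.sound (NGraph.bind_id P)

theorem assoc {W X Y Z : JKGraph.{u}} (φ : KHom W X) (ψ : KHom X Y) (χ : KHom Y Z) :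
    (φ.comp ψ).comp χ = φ.comp (ψ.comp χ) := by
  ext x
  · rfl
  · show NClass.bind (NClass.bind (φ.sub x) ψ) χ = NClass.bind (φ.sub x) (ψ.comp χ)
    generalize φ.sub x = c
    induction c using Quotient.inductionOn with
    | h P => exact Quotient.sound (NGraph.bind_bind P ψ χ)

/-- The graph obtained by gluing the graphs assigned to the vertices of `R`, according to the
recipe that assembles `R` from its vertices and edges. -/
noncomputable def colimitGraph {R Y : JKGraph.{u}} (φ : KHom R Y) : JKGraph.{u} :=
  R.glue (fun x => (φ.sub x).out)

/-- The etale morphism to `Y` from the colimit graph of a Kleisli morphism. -/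
noncomputable def colimitMap {R Y : JKGraph.{u}} (φ : KHom R Y) : Etale φ.colimitGraph Y :=
  R.glueMap (fun x => (φ.sub x).out) φ.arc φ.arc_inv
    (fun x h => (NClass.boundary_out _ _).trans (φ.compat x h))

/-- A Kleisli morphism `R → Y` is generic if its colimit graph is isomorphic to `Y`. -/
def IsGeneric {R Y : JKGraph.{u}} (φ : KHom R Y) : Prop := φ.colimitMap.IsInvertible

end KHom

/-- The objects of the restricted Kleisli category: graphs without isolated edges. -/
structure KleisliGraph : Type (u + 1) where
  graph : JKGraph.{u}
  noIsolatedEdges : graph.NoIsolatedEdges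

/-- The restricted Kleisli category. -/
noncomputable instance : Category.{u + 1} KleisliGraph.{u} where
  Hom R Y := KHom R.graph Y.graph
  id R := KHom.id R.graph
  comp φ ψ := KHom.comp φ ψ
  id_comp := KHom.id_comp
  comp_id := KHom.comp_id
  assoc := KHom.assoc

/-- The reduced covers, as morphisms of the restricted Kleisli category. -/
def reducedCovers : MorphismProperty KleisliGraph.{u} := fun R Y φ =>
  ∃ f : Etale R.graph Y.graph, f.IsReducedCover ∧ φ = KHom.free f

/-- The generic morphisms of the restricted Kleisli category. -/
def genericMorphisms : MorphismProperty KleisliGraph.{u} := fun R Y φ =>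
  KHom.IsGeneric (R := R.graph) (Y := Y.graph) φ

section Cospans

variable {C : Type u} [Category.{v} C]

/-- Two classes of morphisms suitable for forming a category of cospans: both contain the
isomorphisms and are closed under composition, and they admit pushouts along each other, the
resulting two new morphisms being again in the same classes. -/
structure CospanClasses (E M : MorphismProperty C) : Prop where
  iso_left : ∀ {X Y : C} (f : X ⟶ Y), IsIso f → E f
  iso_right : ∀ {X Y : C} (f : X ⟶ Y), IsIso f → M f
  comp_left : ∀ {X Y Z : C} (f : X ⟶ Y) (g : Y ⟶ Z), E f → E g → E (f ≫ g)
  comp_right : ∀ {X Y Z : C} (f : X ⟶ Y) (g : Y ⟶ Z), M f → M g → M (f ≫ g)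
  pushout : ∀ {R R' S : C} (g : R ⟶ S) (r : R ⟶ R'), M g → E r →
    ∃ (S' : C) (r' : S ⟶ S') (g' : R' ⟶ S'), IsPushout g r r' g' ∧ E r' ∧ M g'

/-- A cospan `T → S ← R` with first leg in `E` and second leg in `M`. -/
structure ECospan (E M : MorphismProperty C) (T R : C) where
  apex : C
  fst : T ⟶ apex
  snd : R ⟶ apex
  fst_mem : E fst
  snd_mem : M snd

/-- Isomorphism of cospans. -/
instance ECospan.setoid (E M : MorphismProperty C) (T R : C) : Setoid (ECospan E M T R) where
  r c d := ∃ e : c.apex ≅ d.apex, c.fst ≫ e.hom = d.fst ∧ c.snd ≫ e.hom = d.snd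
  iseqv :=
    { refl := fun _ => ⟨Iso.refl _, by simp, by simp⟩
      symm := by
        rintro c d ⟨e, h1, h2⟩
        exact ⟨e.symm, by simp [← h1], by simp [← h2]⟩
      trans := by
        rintro c d d' ⟨e, h1, h2⟩ ⟨e', h1', h2'⟩
        exact ⟨e ≪≫ e', by simp [← h1', ← h1], by simp [← h2', ← h2]⟩ }

/-- Isomorphism classes of cospans. -/
def CospanClass (E M : MorphismProperty C) (T R : C) := Quotient (ECospan.setoid E M T R)

variable {E M : MorphismProperty C}

/-- The isomorphism class of the cospan with legs `f` and `g`. -/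
def CospanClass.mk {T S R : C} (f : T ⟶ S) (g : R ⟶ S) (hf : E f) (hg : M g) :
    CospanClass E M T R :=
  Quotient.mk _ ⟨S, f, g, hf, hg⟩

theorem CospanClass.mk_eq {T S S' R : C} {f : T ⟶ S} {g : R ⟶ S} {f' : T ⟶ S'} {g' : R ⟶ S'}
    {hf : E f} {hg : M g} {hf' : E f'} {hg' : M g'} (e : S ≅ S') (h1 : f ≫ e.hom = f')
    (h2 : g ≫ e.hom = g') : CospanClass.mk f g hf hg = CospanClass.mk f' g' hf' hg' :=
  Quotient.sound ⟨e, h1, h2⟩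

namespace CospanClasses

/-- The composite of two cospans, by means of a chosen pushout. -/
noncomputable def compAux (h : CospanClasses E M) {X Y Z : C} (c : ECospan E M X Y)
    (d : ECospan E M Y Z) : CospanClass E M X Z :=
  let p := h.pushout c.snd d.fst c.snd_mem d.fst_mem
  CospanClass.mk (c.fst ≫ p.choose_spec.choose) (d.snd ≫ p.choose_spec.choose_spec.choose)
    (h.comp_left _ _ c.fst_mem p.choose_spec.choose_spec.choose_spec.2.1)
    (h.comp_right _ _ d.snd_mem p.choose_spec.choose_spec.choose_spec.2.2)

/-- The composite can be computed by any pushout. -/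
theorem compAux_eq (h : CospanClasses E M) {X Y Z : C} (c : ECospan E M X Y)
    (d : ECospan E M Y Z) {P : C} {i : c.apex ⟶ P} {j : d.apex ⟶ P}
    (sq : IsPushout c.snd d.fst i j) (hi : E i) (hj : M j) :
    h.compAux c d = CospanClass.mk (c.fst ≫ i) (d.snd ≫ j) (h.comp_left _ _ c.fst_mem hi)
      (h.comp_right _ _ d.snd_mem hj) := by
  have sq' := (h.pushout c.snd d.fst c.snd_mem d.fst_mem).choose_spec.choose_spec.choose_spec.1
  exact CospanClass.mk_eq (sq'.isoIsPushout _ _ sq) (by simp) (by simp)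

/-- Composition of isomorphism classes of cospans, by pushout. -/
noncomputable def comp (h : CospanClasses E M) {X Y Z : C} (c : CospanClass E M X Y)
    (d : CospanClass E M Y Z) : CospanClass E M X Z :=
  Quotient.lift₂ h.compAux (by
    rintro c d c' d' ⟨e, h1, h2⟩ ⟨e', h1', h2'⟩
    obtain ⟨P, i, j, sq, hi, hj⟩ := h.pushout c.snd d.fst c.snd_mem d.fst_mem
    have sq' : IsPushout c'.snd d'.fst (e.inv ≫ i) (e'.inv ≫ j) :=
      sq.of_iso (Iso.refl _) e e' (Iso.refl _) (by simp [h2]) (by simp [h1']) (by simp) (by simp)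
    rw [h.compAux_eq c d sq hi hj, h.compAux_eq c' d' sq'
      (h.comp_left _ _ (h.iso_left _ inferInstance) hi)
      (h.comp_right _ _ (h.iso_right _ inferInstance) hj)]
    exact CospanClass.mk_eq (Iso.refl _) (by simp [← h1]) (by simp [← h2'])) c d

theorem comp_mk (h : CospanClasses E M) {X Y Z S S' P : C} {f : X ⟶ S} {g : Y ⟶ S} {f' : Y ⟶ S'}
    {g' : Z ⟶ S'} {hf : E f} {hg : M g} {hf' : E f'} {hg' : M g'} {i : S ⟶ P} {j : S' ⟶ P}
    (sq : IsPushout g f' i j) (hi : E i) (hj : M j) :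
    h.comp (CospanClass.mk f g hf hg) (CospanClass.mk f' g' hf' hg') =
      CospanClass.mk (f ≫ i) (g' ≫ j) (h.comp_left _ _ hf hi) (h.comp_right _ _ hg' hj) :=
  h.compAux_eq ⟨S, f, g, hf, hg⟩ ⟨S', f', g', hf', hg'⟩ sq hi hj

end CospanClasses

/-- The category of cospans: the same objects as `C`, and as morphisms the isomorphism classes of
cospans with first leg in `E` and second leg in `M`, composed by pushout. -/
structure CospanCategory (h : CospanClasses E M) where
  obj : C

noncomputable instance (h : CospanClasses E M) : Category.{max u v} (CospanCategory h) where
  Hom T R := CospanClass E M T.obj R.obj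
  id T := CospanClass.mk (𝟙 T.obj) (𝟙 T.obj) (h.iso_left _ inferInstance)
    (h.iso_right _ inferInstance)
  comp c d := h.comp c d
  id_comp c := by
    induction c using Quotient.inductionOn with
    | h c =>
      refine (h.comp_mk (IsPushout.of_id_fst (f := c.fst)) c.fst_mem
        (h.iso_right _ inferInstance)).trans ?_
      exact CospanClass.mk_eq (Iso.refl _) (by simp) (by simp)
  comp_id c := by
    induction c using Quotient.inductionOn with
    | h c =>
      refine (h.comp_mk (IsPushout.of_id_snd (f := c.snd)) (h.iso_left _ inferInstance)
        c.snd_mem).trans ?_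
      exact CospanClass.mk_eq (Iso.refl _) (by simp) (by simp)
  assoc c c' c'' := by
    induction c using Quotient.inductionOn with | h c => ?_
    induction c' using Quotient.inductionOn with | h c' => ?_
    induction c'' using Quotient.inductionOn with | h c'' => ?_
    obtain ⟨P, i, j, sq, hi, hj⟩ := h.pushout c.snd c'.fst c.snd_mem c'.fst_mem
    obtain ⟨P', i', j', sq', hi', hj'⟩ := h.pushout c'.snd c''.fst c'.snd_mem c''.fst_mem
    obtain ⟨Q, k, l, sq'', hk, hl⟩ := h.pushout j i' hj hi'
    have e1 := h.comp_mk (f := c.fst) (g' := c'.snd) (hf := c.fst_mem) (hg' := c'.snd_mem)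
      (hg := c.snd_mem) (hf' := c'.fst_mem) sq hi hj
    have e2 := h.comp_mk (f := c'.fst) (g' := c''.snd) (hf := c'.fst_mem) (hg' := c''.snd_mem)
      (hg := c'.snd_mem) (hf' := c''.fst_mem) sq' hi' hj'
    have sqa : IsPushout (c'.snd ≫ j) c''.fst k (j' ≫ l) := (sq'.flip.paste_vert sq''.flip).flip
    have sqb : IsPushout c.snd (c'.fst ≫ i') (i ≫ k) l := sq.paste_vert sq''
    refine (congrArg (fun t => h.comp t (Quotient.mk _ c'')) e1).trans ?_
    refine Eq.trans ?_ (congrArg (fun t => h.comp (Quotient.mk _ c) t) e2).symm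
    refine (h.comp_mk sqa hk (h.comp_right _ _ hj' hl)).trans ?_
    refine Eq.trans ?_ (h.comp_mk sqb (h.comp_left _ _ hi hk) hl).symm
    exact CospanClass.mk_eq (Iso.refl _) (by simp) (by simp)

/-- The cospans `r / identity` with `r` in `E` (up to isomorphism of cospans). -/
def leftCospans (h : CospanClasses E M) : MorphismProperty (CospanCategory h) := fun T R c =>
  ∃ (r : T.obj ⟶ R.obj) (hr : E r), c = CospanClass.mk r (𝟙 R.obj) hr (h.iso_right _ inferInstance)

/-- The cospans `identity / g` with `g` in `M` (up to isomorphism of cospans). -/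
def rightCospans (h : CospanClasses E M) : MorphismProperty (CospanCategory h) := fun T R c =>
  ∃ (g : R.obj ⟶ T.obj) (hg : M g), c = CospanClass.mk (𝟙 T.obj) g (h.iso_left _ inferInstance) hg

end Cospans

/-- A pair of classes of morphisms is a factorisation system if both classes contain the
isomorphisms and are closed under composition, and every morphism factors as a morphism of the
first class followed by a morphism of the second class, uniquely up to unique comparison
isomorphism. -/
structure IsFactorisationSystem {C : Type u} [Category.{v} C] (L R : MorphismProperty C) :
    Prop where
  iso_left : ∀ {X Y : C} (f : X ⟶ Y), IsIso f → L f
  iso_right : ∀ {X Y : C} (f : X ⟶ Y), IsIso f → R f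
  comp_left : ∀ {X Y Z : C} (f : X ⟶ Y) (g : Y ⟶ Z), L f → L g → L (f ≫ g)
  comp_right : ∀ {X Y Z : C} (f : X ⟶ Y) (g : Y ⟶ Z), R f → R g → R (f ≫ g)
  exists_factorisation : ∀ {X Y : C} (f : X ⟶ Y),
    ∃ (Z : C) (l : X ⟶ Z) (r : Z ⟶ Y), L l ∧ R r ∧ l ≫ r = f
  unique_comparison : ∀ {X Y Z Z' : C} (l : X ⟶ Z) (r : Z ⟶ Y) (l' : X ⟶ Z') (r' : Z' ⟶ Y),
    L l → R r → L l' → R r' → l ≫ r = l' ≫ r' →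
      ∃! e : Z ≅ Z', l ≫ e.hom = l' ∧ e.hom ≫ r' = r

/-! Without isolated edges, every arc or its opposite is incident to a vertex, so an etale morphism
is governed by its effect on vertices. Minimality makes a reduced cover injective on vertices, and
the reduced covers turn out to be exactly the etale morphisms bijective on vertices
(`isReducedCover_iff`). Such a map moves no inner edge onto another edge (`eq_of_isInner`); all it
can do is join port edges in pairs. Covers are epimorphisms because they are surjective on arcs and
vertices and a Kleisli morphism is determined by its values there.

A generic `g : R → S` presents `S` as the gluing, according to `R`, of labelled graphs `S_x`. A
cover `R → R'` keeps the vertices and their half-edges, so the same graphs can be glued according to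
`R'` instead. The result `S'` receives a vertex-bijective map from `S` and a generic morphism from
`R'` (`exists_square`). The map `S → S'` identifies only arcs of `R` that were already identified in
`R'`, and this gives the pushout property (`exists_isPushout`). Generic morphisms compose by
associativity of substitution.

Substituting effective graphs never loses a vertex or an inner edge. Hence if a composite is free,
its first factor is free (`exists_eq_free`). So isomorphisms are free on invertible etale morphisms,
and a generic morphism that starts an invertible composite of generic morphisms is itself
invertible.

The factorisation system is then formal (`isFactorisationSystem`): it needs only that the first
class consists of epimorphisms and that the second class has this last cancellation property.
Together they force both legs of an invertible cospan to be invertible. -/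

namespace Etale

/-! ### Etale morphisms between graphs without isolated edges -/

variable {G G' G'' : JKGraph.{u}}

/-- By the pullback square, a half-edge of `G` amounts to a vertex together with a half-edge of `G'`
at its image, so injectivity on vertices passes to half-edges. -/
theorem half_injective (f : Etale G G') (hv : Function.Injective f.vert) :
    Function.Injective f.half := by
  intro h k e
  have hp : G.p h = G.p k := hv (by rw [f.vert_p, f.vert_p, e])
  exact (f.pullback (G.p k) (f.half k) (f.vert_p k).symm).unique ⟨hp, e⟩ ⟨rfl, rfl⟩

theorem half_surjective (f : Etale G G') (hv : Function.Surjective f.vert) :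
    Function.Surjective f.half := by
  intro h'
  obtain ⟨x, hx⟩ := hv (G'.p h')
  obtain ⟨h, hh, -⟩ := f.pullback x h' hx.symm
  exact ⟨h, hh.2⟩

theorem arc_surjective (f : Etale G G') (hv : Function.Surjective f.vert)
    (hG' : G'.NoIsolatedEdges) : Function.Surjective f.arc := by
  intro a
  rcases hG' a with ⟨h, rfl⟩ | ⟨h, e⟩
  · obtain ⟨k, rfl⟩ := f.half_surjective hv h
    exact ⟨_, f.arc_s k⟩
  · obtain ⟨k, rfl⟩ := f.half_surjective hv h
    exact ⟨G.inv (G.s k), by rw [f.arc_inv, f.arc_s, e, G'.inv_inv]⟩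

/-- An etale morphism that is injective on vertices is injective on the arcs incident to a
vertex. -/
theorem arc_injOn (f : Etale G G') (hv : Function.Injective f.vert) :
    Set.InjOn f.arc (Set.range G.s) := by
  rintro _ ⟨h, rfl⟩ _ ⟨k, rfl⟩ e
  rw [f.arc_s, f.arc_s] at e
  rw [f.half_injective hv (G'.s_inj e)]

/-- Both arcs of an inner edge are incident to vertices, so whichever arc of the edge of `b` is
incident to a vertex has a counterpart in the edge of `a` to which `arc_injOn` applies. -/
theorem eq_of_isInner (f : Etale G G') (hv : Function.Injective f.vert) (hG : G.NoIsolatedEdges)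
    {a b : G.A} (ha : G.IsInner a) (e : f.arc a = f.arc b) : a = b := by
  rcases hG b with hb | hb
  · exact f.arc_injOn hv ha.1 hb e
  · have := f.arc_injOn hv ha.2 hb (by rw [f.arc_inv, f.arc_inv, e])
    rw [← G.inv_inv a, this, G.inv_inv]

/-- Between graphs without isolated edges, an etale morphism that is bijective on vertices and
sends ports to ports is an isomorphism. -/
theorem isInvertible_of_isPort (f : Etale G G') (hG : G.NoIsolatedEdges)
    (hG' : G'.NoIsolatedEdges) (hv : Function.Bijective f.vert)
    (hp : ∀ a, G.IsPort a → G'.IsPort (f.arc a)) : f.IsInvertible := by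
  have key : ∀ a b, f.arc a = f.arc b → a ∈ Set.range G.s → a = b := by
    intro a b e ha
    by_cases hb : b ∈ Set.range G.s
    · exact f.arc_injOn hv.1 ha hb e
    · obtain ⟨h, rfl⟩ := ha
      exact absurd ⟨_, (f.arc_s h).symm.trans e⟩ (hp b hb)
  refine ⟨⟨?_, f.arc_surjective hv.2 hG'⟩, ⟨f.half_injective hv.1, f.half_surjective hv.2⟩, hv⟩
  intro a b e
  rcases hG a with ha | ha
  · exact key a b e ha
  · have := key _ (G.inv b) (by rw [f.arc_inv, f.arc_inv, e]) ha
    rw [← G.inv_inv a, this, G.inv_inv]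

theorem isInvertible_of_comp_left (f : Etale G G') (g : Etale G' G'') (hf : f.IsInvertible)
    (h : (f.comp g).IsInvertible) : g.IsInvertible :=
  ⟨(Function.Bijective.of_comp_iff g.arc hf.1).1 h.1,
    (Function.Bijective.of_comp_iff g.half hf.2.1).1 h.2.1,
    (Function.Bijective.of_comp_iff g.vert hf.2.2).1 h.2.2⟩

theorem IsInvertible.comp {f : Etale G G'} {g : Etale G' G''} (hf : f.IsInvertible)
    (hg : g.IsInvertible) : (f.comp g).IsInvertible :=
  ⟨hg.1.comp hf.1, hg.2.1.comp hf.2.1, hg.2.2.comp hf.2.2⟩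

theorem IsInvertible.exists_inverse {f : Etale G G'} (hf : f.IsInvertible) :
    ∃ g : Etale G' G, f.comp g = Etale.id G ∧ g.comp f = Etale.id G' := by
  obtain ⟨ha, hh, hv⟩ := hf
  obtain ⟨a, a1, a2⟩ := Function.bijective_iff_has_inverse.1 ha
  obtain ⟨h, h1, h2⟩ := Function.bijective_iff_has_inverse.1 hh
  obtain ⟨x, x1, x2⟩ := Function.bijective_iff_has_inverse.1 hv
  refine ⟨⟨a, h, x, ?_, ?_, ?_, ?_⟩, ?_, ?_⟩
  · intro t; apply ha.1; rw [f.arc_inv, a2, a2]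
  · intro t; apply ha.1; rw [f.arc_s, a2, h2]
  · intro t; apply hv.1; rw [f.vert_p, x2, h2]
  · intro y k hk
    refine ⟨f.half k, ⟨?_, h1 k⟩, ?_⟩
    · rw [← f.vert_p, hk, x2]
    · rintro l ⟨_, rfl⟩; rw [h2]
  · ext t
    exacts [a1 t, h1 t, x1 t]
  · ext t
    exacts [a2 t, h2 t, x2 t]

theorem isInvertible_of_inverse {f : Etale G G'} {g : Etale G' G} (h1 : f.comp g = Etale.id G)
    (h2 : g.comp f = Etale.id G') : f.IsInvertible :=
  ⟨Function.bijective_iff_has_inverse.2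
      ⟨g.arc, fun t => congrFun (congrArg Etale.arc h1) t, fun t => congrFun (congrArg Etale.arc h2) t⟩,
    Function.bijective_iff_has_inverse.2
      ⟨g.half, fun t => congrFun (congrArg Etale.half h1) t,
        fun t => congrFun (congrArg Etale.half h2) t⟩,
    Function.bijective_iff_has_inverse.2
      ⟨g.vert, fun t => congrFun (congrArg Etale.vert h1) t,
        fun t => congrFun (congrArg Etale.vert h2) t⟩⟩

/-- Between graphs without isolated edges, the reduced covers are the etale morphisms that are
bijective on vertices. -/
theorem isReducedCover_iff (f : Etale G G') (hG : G.NoIsolatedEdges) (hG' : G'.NoIsolatedEdges) :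
    f.IsReducedCover ↔ Function.Bijective f.vert := by
  constructor
  · rintro ⟨ha, hv, hU⟩
    refine ⟨?_, hv⟩
    -- All arcs, with one chosen preimage for each vertex of `G'`, form an open subgraph that still
    -- covers. By minimality every vertex of `G` is a chosen preimage.
    have h := (hU ⟨Set.univ, Set.range (Function.surjInv hv), fun _ _ => trivial,
      fun _ _ => trivial⟩ (by rw [Set.image_univ, ha.range_eq]) (by
        refine Set.eq_univ_of_forall fun y => ⟨_, ⟨y, rfl⟩, Function.surjInv_eq hv y⟩)).2
    dsimp only at h
    intro x y e
    obtain ⟨x', rfl⟩ : x ∈ Set.range (Function.surjInv hv) := h ▸ trivial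
    obtain ⟨y', rfl⟩ : y ∈ Set.range (Function.surjInv hv) := h ▸ trivial
    rw [Function.surjInv_eq hv, Function.surjInv_eq hv] at e
    rw [e]
  · intro hv
    refine ⟨f.arc_surjective hv.2 hG', hv.2, fun U _ hUv => ?_⟩
    have hV : U.verts = Set.univ := by
      refine Set.eq_univ_of_forall fun x => ?_
      obtain ⟨y, hy, e⟩ : f.vert x ∈ f.vert '' U.verts := hUv ▸ trivial
      rwa [← hv.1 e]
    refine ⟨Set.eq_univ_of_forall fun a => ?_, hV⟩
    rcases hG a with ⟨h, rfl⟩ | ⟨h, e⟩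
    · exact U.s_mem h (hV ▸ trivial)
    · rw [← G.inv_inv a, ← e]
      exact U.inv_mem _ (U.s_mem h (hV ▸ trivial))

end Etale

/-! ### Gluing and substitution of labelled graphs -/

namespace JKGraph

/-- Isomorphic gluing data yield isomorphic morphisms from the glued graphs. -/
theorem glueMap_isInvertible_iff {G G' Z : JKGraph.{u}} (hG : G.NoIsolatedEdges)
    (hG' : G'.NoIsolatedEdges) {K : ∀ x : G.V, NGraph (G.Flag x) Z}
    {K' : ∀ x : G'.V, NGraph (G'.Flag x) Z} (e : Etale G G') (he : e.IsInvertible)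
    (θ : ∀ x, NGraph.Rel (K x) ((K' (e.vert x)).reindex (e.flagEquiv x)))
    {α hα hK α' hα' hK'} (hh : ∀ a, α' (e.arc a) = α a) :
    (G.glueMap K α hα hK).IsInvertible ↔ (G'.glueMap K' α' hα' hK').IsInvertible := by
  obtain ⟨F, h1, h2, h3⟩ := exists_glueHom e θ
  have hF : F.IsInvertible := by
    refine F.isInvertible_of_isPort (glue_noIsolatedEdges hG) (glue_noIsolatedEdges hG')
      (h2 he.2.2) ?_
    -- The ports of the glued graphs are those of `G` and `G'`, and the invertible `e` preserves
    -- them.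
    rintro (a | a) ha
    · rw [h1, glue_inl_isPort]
      rw [glue_inl_isPort] at ha
      rintro ⟨h, hh⟩
      obtain ⟨k, rfl⟩ := he.2.1.2 h
      rw [← e.arc_s] at hh
      exact ha ⟨k, he.1.1 hh⟩
    · exact absurd (glue_inr_mem a) ha
  rw [← h3 α hα hK α' hα' hK' hh]
  exact ⟨F.isInvertible_of_comp_left _ hF, hF.comp⟩

end JKGraph

namespace NGraph

variable {n : Type u} {Y Z : JKGraph.{u}}

theorem out_rel (P : NGraph n Y) : Rel (Quotient.mk (setoid n Y) P).out P :=
  Quotient.exact (s := setoid _ _) (Quotient.out_eq _)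

/-- Postcomposition of the structure morphism of an `n`-graph with an etale morphism. -/
def push (P : NGraph n Y) (f : Etale Y Z) : NGraph n Z where
  G := P.G
  eff := P.eff
  port := P.port
  map := P.map.comp f

theorem Rel.push {P Q : NGraph n Y} (r : Rel P Q) (f : Etale Y Z) :
    Rel (P.push f) (Q.push f) := by
  obtain ⟨e, he, hp, hm⟩ := r
  exact ⟨e, he, hp, congrArg (fun g => Etale.comp g f) hm⟩

/-- Both sides compute the substitution of the identity into `corolla f x`, one by each unit law. -/
theorem corolla_rel (f : Etale Y Z) (x : Y.V) :
    Rel (corolla f x) ((corolla (Etale.id Z) (f.vert x)).reindex (f.flagEquiv x)) :=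
  (bind_id _).symm.trans ((bind_corolla f (KHom.id Z) x).trans
    (Rel.reindex _ (out_rel (corolla (Etale.id Z) (f.vert x)))))

/-- The corollas substituted by `free f` are those that the identity of `Z` substitutes into `P.push
f`, so the right unit law `bind_id` applies. -/
theorem bind_free (P : NGraph n Y) (f : Etale Y Z) : Rel (P.bind (KHom.free f)) (P.push f) := by
  refine Rel.trans ?_ (bind_id (P.push f))
  refine subst_rel (P' := P.push f) (Etale.id _) Function.bijective_id (fun _ => rfl) (fun x => ?_)
    (fun _ => rfl)
  have h : Rel (P.family (KHom.free f) x) (((corolla (Etale.id Z) (f.vert (P.map.vert x))).reindex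
      (f.flagEquiv _)).reindex (P.map.flagEquiv x)) :=
    Rel.reindex _ ((out_rel _).trans (corolla_rel f _))
  exact h.trans (Rel.reindex (P.map.flagEquiv x) (Rel.reindex (f.flagEquiv _) (out_rel _).symm))

/-- An `n`-graph with a single vertex and without inner edges is a corolla. -/
theorem exists_rel_corolla (P : NGraph n Y) (hV : Subsingleton P.G.V)
    (hA : ∀ a, ¬ P.G.IsInner a) :
    ∃ (y : Y.V) (j : n ≃ Y.Flag y), Rel P ((corolla (Etale.id Y) y).reindex j) := by
  obtain ⟨x⟩ := P.eff.1
  have hport : ∀ h, P.G.IsPort (P.G.inv (P.G.s h)) := fun h hh => hA _ ⟨⟨h, rfl⟩, hh⟩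
  -- With one vertex and no inner edge, half-edges correspond to ports by passing to the opposite
  -- arc.
  let t : P.G.Flag x ≃ {a : P.G.A // P.G.IsPort a} :=
    Equiv.ofBijective (fun h => ⟨_, hport h.1⟩) <| by
      constructor
      · intro h k e
        have := congrArg P.G.inv (congrArg Subtype.val e)
        simp only [JKGraph.inv_inv] at this
        exact Subtype.ext (P.G.s_inj this)
      · rintro ⟨a, ha⟩
        rcases P.eff.2 a with ha' | ⟨h, e⟩
        · exact absurd ha' ha
        · exact ⟨⟨h, Subsingleton.elim _ _⟩, Subtype.ext (by simp only [e, P.G.inv_inv])⟩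
  let j := P.port.trans t.symm
  refine ⟨P.map.vert x, j.trans (P.map.flagEquiv x), Rel.trans (Rel.symm ?_)
    (Rel.reindex j (corolla_rel P.map x))⟩
  have hp : ∀ k, (P.G.corollaMap x).arc (((corolla P.map x).reindex j).port k).1 = (P.port k).1 :=
    fun k => congrArg Subtype.val (t.apply_symm_apply (P.port k))
  exact ⟨P.G.corollaMap x, isInvertible_of ((corolla P.map x).reindex j) P (P.G.corollaMap x)
    ⟨fun _ _ _ => rfl, fun y => ⟨PUnit.unit, Subsingleton.elim _ _⟩⟩ hp, hp, rfl⟩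

theorem corolla_not_isInner (f : Etale Y Z) (x : Y.V) (a) : ¬ (corolla f x).G.IsInner a := by
  rintro ⟨⟨h, rfl⟩, k, hk⟩
  cases hk

/-- An `n`-graph that becomes a corolla after substitution is a corolla. -/
theorem exists_rel_corolla_of_bind {W : JKGraph.{u}} (P : NGraph n Y) (ψ : KHom Y Z)
    (f : Etale W Z) (x : W.V) (j : n ≃ W.Flag x)
    (r : Rel (P.bind ψ) ((corolla f x).reindex j)) :
    ∃ (y : Y.V) (j : n ≃ Y.Flag y), Rel P ((corolla (Etale.id Y) y).reindex j) := by
  obtain ⟨e, he, -⟩ := r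
  refine P.exists_rel_corolla ⟨fun v w => ?_⟩ fun a ha => ?_
  -- Effective graphs have a vertex, so distinct vertices of `P` would give distinct vertices of the
  -- corolla.
  · obtain ⟨v'⟩ := (P.family ψ v).eff.1
    obtain ⟨w'⟩ := (P.family ψ w).eff.1
    exact (Sigma.mk.inj (he.2.2.1 (a₁ := ⟨v, v'⟩) (a₂ := ⟨w, w'⟩) rfl)).1
  -- An inner edge of `P` stays inner after substitution, but a corolla has none.
  · refine corolla_not_isInner f x (e.arc (Sum.inl a)) ⟨?_, ?_⟩
    · obtain ⟨h, rfl⟩ := ha.1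
      obtain ⟨k, hk⟩ := JKGraph.glue_inl_mem (K := P.family ψ) h
      rw [← hk]
      exact ⟨_, (e.arc_s k).symm⟩
    · obtain ⟨h, hh⟩ := ha.2
      obtain ⟨k, hk⟩ := JKGraph.glue_inl_mem (K := P.family ψ) h
      rw [hh] at hk
      refine ⟨e.half k, (e.arc_s k).symm.trans ((congrArg e.arc hk).trans ?_)⟩
      exact e.arc_inv (Sum.inl a)

end NGraph

/-! ### Free and generic Kleisli morphisms -/

namespace KHom

variable {R S Y Z : JKGraph.{u}}

theorem free_comp_sub (f : Etale R Y) (φ : KHom Y Z) (x : R.V) :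
    ((free f).comp φ).sub x = (φ.sub (f.vert x)).reindex (f.flagEquiv x) := by
  refine (Quotient.sound (NGraph.bind_corolla f φ x)).trans ?_
  conv_rhs => rw [← Quotient.out_eq (φ.sub (f.vert x))]
  rfl

theorem free_comp_free (f : Etale R Y) (g : Etale Y Z) :
    (free f).comp (free g) = free (f.comp g) := by
  ext x
  · rfl
  · exact Quotient.sound (NGraph.bind_free (NGraph.corolla f x) g)

/-- The arcs determine the half-edges, as `s` is injective, but not the vertices without half-edges.
The vertices are read off from the corollas over `Y`. -/
theorem free_injective : Function.Injective (free (G := R) (G' := Y)) := by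
  intro f g e
  have ha : f.arc = g.arc := congrArg KHom.arc e
  ext t
  · exact congrFun ha t
  · apply Y.s_inj
    rw [← f.arc_s, ← g.arc_s, ha]
  · have : (free f).sub t = (free g).sub t := by rw [e]
    obtain ⟨i, -, -, h⟩ := Quotient.exact this
    exact congrFun (congrArg Etale.vert h).symm PUnit.unit

/-- Two Kleisli morphisms agree if they do so after precomposition with an etale morphism that is
surjective on arcs and vertices. -/
theorem free_comp_cancel (f : Etale R Y) (ha : Function.Surjective f.arc)
    (hv : Function.Surjective f.vert) {φ ψ : KHom Y Z} (e : (free f).comp φ = (free f).comp ψ) :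
    φ = ψ := by
  ext y
  · obtain ⟨x, rfl⟩ := ha y
    exact congrFun (congrArg KHom.arc e) x
  · obtain ⟨x, rfl⟩ := hv y
    have h : ((free f).comp φ).sub x = ((free f).comp ψ).sub x := by rw [e]
    rw [free_comp_sub, free_comp_sub] at h
    have inv : ∀ c : NClass (Y.Flag (f.vert x)) Z,
        (c.reindex (f.flagEquiv x)).reindex (f.flagEquiv x).symm = c := by
      intro c
      induction c using Quotient.inductionOn with | h P => ?_
      have : (P.reindex (f.flagEquiv x)).reindex (f.flagEquiv x).symm = P := by
        simp [NGraph.reindex, ← Equiv.trans_assoc]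
      exact congrArg (Quotient.mk _) this
    rw [← inv (φ.sub _), h, inv]

/-- If a composite of Kleisli morphisms is free, then the first factor is free. -/
theorem exists_eq_free (φ : KHom R Y) (ψ : KHom Y Z) (f : Etale R Z)
    (e : φ.comp ψ = free f) : ∃ g : Etale R Y, φ = free g := by
  have h : ∀ x, ∃ (y : Y.V) (j : R.Flag x ≃ Y.Flag y),
      φ.sub x = Quotient.mk _ ((NGraph.corolla (Etale.id Y) y).reindex j) := by
    intro x
    have h : (φ.sub x).bind ψ = Quotient.mk _ (NGraph.corolla f x) :=
      congrFun (congrArg KHom.sub e) x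
    rw [← Quotient.out_eq (φ.sub x)] at h
    obtain ⟨y, j, r⟩ := NGraph.exists_rel_corolla_of_bind (φ.sub x).out ψ f x (Equiv.refl _)
      (Quotient.exact h)
    exact ⟨y, j, (Quotient.out_eq (φ.sub x)).symm.trans (Quotient.sound r)⟩
  -- These are the vertex and half-edge maps of the required `g`. Bijectivity of `j x` is the
  -- pullback condition, and `compat` at the ports gives compatibility with `s`.
  choose y j hj using h
  have harc : ∀ x (h : R.Flag x), φ.arc (R.s h.1) = Y.s (j x h).1 := by
    intro x h
    have := φ.compat x h
    rw [hj] at this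
    have : Y.inv (Y.s (j x h).1) = φ.arc (R.inv (R.s h.1)) := this
    rw [← Y.inv_inv (φ.arc _), ← φ.arc_inv, ← this, Y.inv_inv]
  let g : Etale R Y :=
    { arc := φ.arc
      half := fun h => (j (R.p h) ⟨h, rfl⟩).1
      vert := y
      arc_inv := φ.arc_inv
      arc_s := fun h => harc _ ⟨h, rfl⟩
      vert_p := fun h => (j (R.p h) ⟨h, rfl⟩).2.symm
      pullback := by
        intro x h' e
        obtain ⟨⟨h, rfl⟩, hh⟩ := (j x).surjective ⟨h', e⟩
        refine ⟨h, ⟨rfl, congrArg Subtype.val hh⟩, ?_⟩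
        rintro k ⟨hk, hk'⟩
        -- Stated for a variable `x`, so that `R.p k = x` can be eliminated from the dependent type
        -- of `j`.
        have : ∀ x, R.p k = x → ∀ h2 : R.Flag x, (j (R.p k) ⟨k, rfl⟩).1 = (j x h2).1 →
            k = h2.1 := by
          rintro _ rfl h2 e2
          exact congrArg Subtype.val ((j (R.p k)).injective (Subtype.ext e2))
        exact this _ hk ⟨h, rfl⟩ (hk'.trans (congrArg Subtype.val hh).symm) }
  refine ⟨g, ?_⟩
  ext x
  · rfl
  · rw [hj]
    have hg : g.flagEquiv x = j x := by
      ext ⟨h, rfl⟩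
      rfl
    have := NGraph.corolla_rel g x
    rw [hg] at this
    exact (Quotient.sound this).symm

/-- Genericity can be tested on any representatives of the graphs assigned to the vertices. -/
theorem isGeneric_iff (φ : KHom R Y) (hR : R.NoIsolatedEdges)
    (K : ∀ x : R.V, NGraph (R.Flag x) Y) (h : ∀ x, φ.sub x = Quotient.mk _ (K x)) (hK) :
    φ.IsGeneric ↔ (R.glueMap K φ.arc φ.arc_inv hK).IsInvertible := by
  refine JKGraph.glueMap_isInvertible_iff hR hR (Etale.id R)
    ⟨Function.bijective_id, Function.bijective_id, Function.bijective_id⟩ (fun x => ?_)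
    (fun _ => rfl)
  have : NGraph.Rel (φ.sub x).out (K x) := by rw [h]; exact NGraph.out_rel _
  exact this

/-- Gluing the corollas of `R` gives back `R`: they have no inner edges, so no arcs are added, and
each contributes one vertex with its own half-edges. -/
theorem isGeneric_free_iff (f : Etale R Y) (hR : R.NoIsolatedEdges) :
    (free f).IsGeneric ↔ f.IsInvertible := by
  rw [isGeneric_iff (free f) hR (NGraph.corolla f) (fun _ => rfl) (fun _ _ => rfl)]
  have hA : Function.Bijective
      (Sum.inl : R.A → (R.glue (NGraph.corolla f)).A) :=
    ⟨Sum.inl_injective, by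
      rintro (a | a)
      · exact ⟨a, rfl⟩
      · exact (NGraph.corolla_not_isInner f _ _ a.2.2).elim⟩
  have hH : Function.Bijective (fun h : (R.glue (NGraph.corolla f)).H => (h.2.1 : R.H)) := by
    constructor
    · rintro ⟨x, h, rfl⟩ ⟨y, k, rfl⟩ (rfl : h = k)
      rfl
    · exact fun h => ⟨⟨R.p h, h, rfl⟩, rfl⟩
  have hV : Function.Bijective (fun y : (R.glue (NGraph.corolla f)).V => (y.1 : R.V)) := by
    constructor
    · rintro ⟨x, ⟨⟩⟩ ⟨y, ⟨⟩⟩ (rfl : x = y)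
      rfl
    · exact fun x => ⟨⟨x, PUnit.unit⟩, rfl⟩
  refine and_congr ?_ (and_congr ?_ ?_)
  · exact (Function.Bijective.of_comp_iff _ hA).symm
  · exact Function.Bijective.of_comp_iff f.half hH
  · exact Function.Bijective.of_comp_iff f.vert hV

/-- Genericity of `ψ` can be tested on its action on any `n`-graph over the source of `ψ` whose
structure morphism is invertible. -/
theorem isGeneric_iff_bind {n : Type u} (P : NGraph n Y) (hP : P.map.IsInvertible)
    (hY : Y.NoIsolatedEdges) (ψ : KHom Y Z) : ψ.IsGeneric ↔ (P.bind ψ).map.IsInvertible := by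
  have hα : ∀ a, ψ.arc (P.map.arc (P.G.inv a)) = Z.inv (ψ.arc (P.map.arc a)) := fun a => by
    rw [P.map.arc_inv, ψ.arc_inv]
  have hK : ∀ x (h : P.G.Flag x), (P.family ψ x).map.arc ((P.family ψ x).port h).1 =
      ψ.arc (P.map.arc (P.G.inv (P.G.s h.1))) := fun x h => by
    refine (NClass.boundary_out _ _).trans ((ψ.compat _ _).trans ?_)
    rw [Etale.flagEquiv_val, P.map.arc_inv, P.map.arc_s]
  exact (JKGraph.glueMap_isInvertible_iff P.eff.2 hY (K := P.family ψ)
    (K' := fun y => (ψ.sub y).out) (hα := hα) (hK := hK) P.map hP (fun _ => NGraph.Rel.refl _)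
    (fun _ => rfl)).symm

/-- Regard `R` as a graph labelled by its own ports. Gluing becomes `bind`, and `bind_bind`
identifies the gluing for the composite with the gluing for `ψ` over that for `φ`. -/
theorem IsGeneric.comp {φ : KHom R Y} {ψ : KHom Y Z} (hR : R.NoIsolatedEdges)
    (hY : Y.NoIsolatedEdges) (hZ : Z.NoIsolatedEdges) (hφ : φ.IsGeneric) (hψ : ψ.IsGeneric) :
    (φ.comp ψ).IsGeneric := by
  by_cases hV : Nonempty R.V
  · let P : NGraph _ R := ⟨R, ⟨hV, hR⟩, Equiv.refl _, Etale.id R⟩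
    have hP : P.map.IsInvertible :=
      ⟨Function.bijective_id, Function.bijective_id, Function.bijective_id⟩
    rw [isGeneric_iff_bind P hP hR] at hφ ⊢
    rw [isGeneric_iff_bind _ hφ hY] at hψ
    obtain ⟨e, he, -, hm⟩ := NGraph.bind_bind P φ ψ
    rw [← hm] at hψ
    exact e.isInvertible_of_comp_left _ he hψ
  -- A graph without vertices is not effective, so `bind` is unavailable. Here `Y` and `Z` have no
  -- vertices either, by surjectivity of the colimit maps.
  · have h1 : IsEmpty R.V := not_nonempty_iff.1 hV
    have h2 : IsEmpty Y.V := ⟨fun y => by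
      obtain ⟨x, -⟩ := hφ.2.2.2 y
      exact h1.elim x.1⟩
    have h3 : IsEmpty Z.V := ⟨fun z => by
      obtain ⟨y, -⟩ := hψ.2.2.2 z
      exact h2.elim y.1⟩
    have h4 : IsEmpty (φ.comp ψ).colimitGraph.V := ⟨fun x => h1.elim x.1⟩
    refine Etale.isInvertible_of_isPort _ (JKGraph.glue_noIsolatedEdges hR) hZ
      ⟨fun x => h4.elim x, fun z => h3.elim z⟩ fun a ha => ?_
    rcases JKGraph.glue_noIsolatedEdges (K := fun x => ((φ.comp ψ).sub x).out) hR a with h | ⟨h, -⟩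
    · exact absurd h ha
    · exact h1.elim h.1

end KHom

/-! ### Construction of the pushout square -/

namespace KHom

variable {R R' S S' Y Z : JKGraph.{u}}

/-- A Kleisli morphism factors through an etale morphism that is bijective on vertices and
surjective on arcs as soon as its map on arcs does. -/
theorem exists_free_comp_eq (f : Etale S S') (hv : Function.Bijective f.vert)
    (ha : Function.Surjective f.arc) (ψ : KHom S Z)
    (h : ∀ a b, f.arc a = f.arc b → ψ.arc a = ψ.arc b) :
    ∃ θ : KHom S' Z, (free f).comp θ = ψ := by
  -- The choice of preimages is immaterial by `h`.
  let β : S'.A → Z.A := fun a => ψ.arc (Function.surjInv ha a)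
  have hβ : ∀ a, β (f.arc a) = ψ.arc a := fun a => h _ _ (Function.surjInv_eq ha _)
  -- The class at `y` is transported from the unique vertex over it. The quantified equation `hx`
  -- keeps `y` a variable, so that the label types match.
  have H : ∀ y, ∃ c : NClass (S'.Flag y) Z, (∀ k, c.boundary k = β (S'.inv (S'.s k.1))) ∧
      ∀ x (hx : f.vert x = y), c.reindex (hx ▸ f.flagEquiv x) = ψ.sub x := by
    intro y
    obtain ⟨x, rfl⟩ := hv.2 y
    have hb := ψ.compat x
    generalize hc : ψ.sub x = c at hb
    induction c using Quotient.inductionOn with | h P => ?_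
    refine ⟨Quotient.mk _ (P.reindex (f.flagEquiv x).symm), fun k => ?_, fun x' hx => ?_⟩
    · obtain ⟨k, rfl⟩ := (f.flagEquiv x).surjective k
      rw [Etale.flagEquiv_val, ← f.arc_s, ← f.arc_inv, hβ, ← hb]
      show P.map.arc (P.port ((f.flagEquiv x).symm (f.flagEquiv x k))).1 = P.map.arc (P.port k).1
      rw [Equiv.symm_apply_apply]
    · obtain rfl := hv.1 hx
      rw [hc]
      have : (P.reindex (f.flagEquiv x').symm).reindex (f.flagEquiv x') = P := by
        simp [NGraph.reindex, ← Equiv.trans_assoc]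
      exact congrArg (Quotient.mk _) this
  choose c hc hc' using H
  refine ⟨⟨β, fun a => ?_, c, hc⟩, ?_⟩
  · obtain ⟨a, rfl⟩ := ha a
    rw [← f.arc_inv, hβ, hβ, ψ.arc_inv]
  · ext x
    · exact hβ x
    · exact (free_comp_sub f _ x).trans (hc' _ x rfl)

/-- The square completing a span formed by a generic morphism and an etale morphism that is
bijective on vertices, obtained by substituting the graphs given by the generic morphism into the
target of the etale morphism. -/
theorem exists_square (g : KHom R S) (hg : g.IsGeneric) (f : Etale R R')
    (hv : Function.Bijective f.vert) (hR : R.NoIsolatedEdges) (hR' : R'.NoIsolatedEdges) :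
    ∃ (S' : JKGraph.{u}) (q : Etale S S') (g' : KHom R' S'), S'.NoIsolatedEdges ∧
      Function.Bijective q.vert ∧ g'.IsGeneric ∧ g.comp (free q) = (free f).comp g' ∧
      ∀ a b, q.arc a = q.arc b →
        a = b ∨ ∃ a' b', a = g.arc a' ∧ b = g.arc b' ∧ f.arc a' = f.arc b' := by
  let K := fun x => (g.sub x).out
  have hK : ∀ x (h : R.Flag x), (K x).map.arc ((K x).port h).1 = g.arc (R.inv (R.s h.1)) :=
    fun x h => (NClass.boundary_out _ _).trans (g.compat x h)
  -- The graph at `x` is moved to `f.vert x`, its labels transported along the bijection of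
  -- half-edges.
  have H : ∀ y, ∃ K' : NGraph (R'.Flag y) S, ∀ x (hx : f.vert x = y),
      NGraph.Rel (K x) (K'.reindex (hx ▸ f.flagEquiv x)) := by
    intro y
    obtain ⟨x, rfl⟩ := hv.2 y
    refine ⟨(K x).reindex (f.flagEquiv x).symm, fun x' hx => ?_⟩
    obtain rfl := hv.1 hx
    have : ((K x').reindex (f.flagEquiv x').symm).reindex (f.flagEquiv x') = K x' := by
      simp [NGraph.reindex, ← Equiv.trans_assoc]
    show NGraph.Rel (K x') (((K x').reindex (f.flagEquiv x').symm).reindex (f.flagEquiv x'))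
    rw [this]
    exact NGraph.Rel.refl _
  choose K' θ using H
  have θ : ∀ x, NGraph.Rel (K x) ((K' (f.vert x)).reindex (f.flagEquiv x)) := fun x => θ _ x rfl
  obtain ⟨F, F1, F2, -⟩ := JKGraph.exists_glueHom f θ
  obtain ⟨i, hi, hi'⟩ := hg.exists_inverse
  -- Genericity identifies `S` with the gluing according to `R`; `F` then passes to the gluing
  -- according to `R'`.
  let q : Etale S (R'.glue K') := i.comp F
  have hq : g.colimitMap.comp q = F := congrArg (fun e => Etale.comp e F) hi
  have hiv : Function.Bijective i.vert := (Etale.isInvertible_of_inverse hi' hi).2.2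
  have hqv : Function.Bijective q.vert := (F2 hv).comp hiv
  have hqa : ∀ a, q.arc (g.arc a) = Sum.inl (f.arc a) := fun a =>
    (congrFun (congrArg Etale.arc hq) (Sum.inl a)).trans (F1 a)
  have hb : ∀ y (h : R'.Flag y), q.arc ((K' y).map.arc ((K' y).port h).1) =
      Sum.inl (R'.inv (R'.s h.1)) := by
    intro y h
    obtain ⟨x, rfl⟩ := hv.2 y
    obtain ⟨h, rfl⟩ := (f.flagEquiv x).surjective h
    obtain ⟨e, -, hp, hm⟩ := θ x
    have h1 : (K' (f.vert x)).map.arc ((K' (f.vert x)).port (f.flagEquiv x h)).1 =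
        g.arc (R.inv (R.s h.1)) := by
      rw [← hK x h, ← hm]
      exact (congrArg (K' (f.vert x)).map.arc (hp h)).symm
    rw [h1, hqa, f.arc_inv, f.arc_s]
    rfl
  let g' : KHom R' (R'.glue K') :=
    ⟨Sum.inl, fun _ => rfl, fun y => Quotient.mk _ ((K' y).push q), hb⟩
  have hS' : (R'.glue K').NoIsolatedEdges := JKGraph.glue_noIsolatedEdges hR'
  refine ⟨R'.glue K', q, g', hS', hqv, ?_, ?_, ?_⟩
  -- The map to be inverted sends ports to ports, so bijectivity on vertices suffices. This holds
  -- because its composite with the vertex-bijective `F'` agrees with `F` on vertices.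
  · rw [isGeneric_iff g' hR' (fun y => (K' y).push q) (fun _ => rfl) hb]
    let α : R.A → (R'.glue K').A := fun a => Sum.inl (f.arc a)
    have hα : ∀ a, α (R.inv a) = (R'.glue K').inv (α a) := fun a => congrArg Sum.inl (f.arc_inv a)
    have hKq : ∀ x (h : R.Flag x), ((K x).push q).map.arc (((K x).push q).port h).1 =
        α (R.inv (R.s h.1)) := fun x h =>
      (congrArg q.arc (hK x h)).trans (hqa _)
    obtain ⟨F', -, F2', F3'⟩ := JKGraph.exists_glueHom (K := fun x => (K x).push q)
      (K' := fun y => (K' y).push q) f (fun x => (θ x).push q)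
    have h3 := F3' _ hα hKq g'.arc g'.arc_inv hb (fun _ => rfl)
    have hF : Function.Bijective (R.glueMap (fun x => (K x).push q) α hα hKq).vert := by
      have : (R.glueMap (fun x => (K x).push q) α hα hKq).vert = F.vert := by
        rw [← hq]
        rfl
      rw [this]
      exact F2 hv
    rw [← h3] at hF
    refine Etale.isInvertible_of_isPort _ (JKGraph.glue_noIsolatedEdges hR') hS'
      ((Function.Bijective.of_comp_iff _ (F2' hv)).1 hF) ?_
    rintro (a | a) ha
    · exact (JKGraph.glue_inl_isPort a).2 ((JKGraph.glue_inl_isPort a).1 ha)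
    · exact absurd (JKGraph.glue_inr_mem a) ha
  · ext x
    · exact hqa x
    · rw [free_comp_sub]
      show (g.sub x).bind (free q) = _
      conv_lhs => rw [← Quotient.out_eq (g.sub x)]
      refine Quotient.sound (((K x).bind_free q).trans ((θ x).push q))
  · intro a b e
    obtain ⟨a, rfl⟩ := hg.1.2 a
    obtain ⟨b, rfl⟩ := hg.1.2 b
    have e : F.arc a = F.arc b := by rw [← hq]; exact e
    -- Arcs interior to a substituted graph are identified with no other arc, so every collapse
    -- comes from arcs of `R`.
    have inner : ∀ c, (R.glue K).IsInner (Sum.inr c) := fun c =>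
      ⟨JKGraph.glue_inr_mem c, JKGraph.glue_inr_mem _⟩
    rcases a with a | a
    · rcases b with b | b
      · refine Or.inr ⟨a, b, rfl, rfl, ?_⟩
        rw [F1, F1] at e
        exact Sum.inl.inj e
      · left
        rw [F.eq_of_isInner (F2 hv).1 (JKGraph.glue_noIsolatedEdges hR) (inner b) e.symm]
    · left
      rw [F.eq_of_isInner (F2 hv).1 (JKGraph.glue_noIsolatedEdges hR) (inner a) e]

end KHom

/-! ### Reduced covers and generic morphisms in the restricted Kleisli category -/

namespace KleisliGraph

theorem epi_of_reducedCovers {R R' : KleisliGraph.{u}} (r : R ⟶ R') (hr : reducedCovers r) :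
    Epi r := by
  obtain ⟨f, hf, rfl⟩ := hr
  exact ⟨fun _ _ e => KHom.free_comp_cancel f hf.1 hf.2.1 e⟩

theorem isIso_free {R Y : KleisliGraph.{u}} (f : Etale R.graph Y.graph) (hf : f.IsInvertible) :
    IsIso (C := KleisliGraph.{u}) (X := R) (Y := Y) (KHom.free f) := by
  obtain ⟨g, h1, h2⟩ := hf.exists_inverse
  exact ⟨(KHom.free g : KHom Y.graph R.graph),
    (KHom.free_comp_free f g).trans (congrArg KHom.free h1),
    (KHom.free_comp_free g f).trans (congrArg KHom.free h2)⟩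

/-- Identities are free, so `exists_eq_free` applies to the isomorphism and to its inverse. -/
theorem exists_eq_free_of_isIso {R Y : KleisliGraph.{u}} (φ : R ⟶ Y) (hφ : IsIso φ) :
    ∃ f : Etale R.graph Y.graph, f.IsInvertible ∧ φ = KHom.free f := by
  obtain ⟨ψ, h1, h2⟩ := hφ
  obtain ⟨f, rfl⟩ := KHom.exists_eq_free φ ψ (Etale.id _) h1
  obtain ⟨g, rfl⟩ := KHom.exists_eq_free ψ (KHom.free f) (Etale.id _) h2
  exact ⟨f, Etale.isInvertible_of_inverse
    (KHom.free_injective ((KHom.free_comp_free f g).symm.trans h1))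
    (KHom.free_injective ((KHom.free_comp_free g f).symm.trans h2)), rfl⟩

theorem reducedCovers_free_iff {R Y : KleisliGraph.{u}} (f : Etale R.graph Y.graph) :
    reducedCovers (X := R) (Y := Y) (KHom.free f) ↔ Function.Bijective f.vert := by
  rw [← f.isReducedCover_iff R.noIsolatedEdges Y.noIsolatedEdges]
  refine ⟨?_, fun h => ⟨f, h, rfl⟩⟩
  rintro ⟨g, hg, e⟩
  rwa [KHom.free_injective e]

/-- If the composite of two generic morphisms is invertible, then so is the first one. -/
theorem isIso_of_genericMorphisms {X Y Z : KleisliGraph.{u}} (φ : X ⟶ Y) (ψ : Y ⟶ Z)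
    (hφ : genericMorphisms φ) (h : IsIso (φ ≫ ψ)) : IsIso φ := by
  obtain ⟨e, -, he⟩ := exists_eq_free_of_isIso _ h
  obtain ⟨f, rfl⟩ := KHom.exists_eq_free φ ψ e he
  exact isIso_free f ((KHom.isGeneric_free_iff f X.noIsolatedEdges).1 hφ)

/-- Only descent along the new cover needs an argument. Compatibility with the other leg and
uniqueness follow because both covers are epimorphisms. -/
theorem exists_isPushout {R R' S : KleisliGraph.{u}} (g : R ⟶ S) (r : R ⟶ R')
    (hg : genericMorphisms g) (hr : reducedCovers r) :
    ∃ (S' : KleisliGraph.{u}) (r' : S ⟶ S') (g' : R' ⟶ S'),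
      IsPushout g r r' g' ∧ reducedCovers r' ∧ genericMorphisms g' := by
  have hepi := epi_of_reducedCovers r hr
  obtain ⟨f, hf, rfl⟩ := hr
  have hv := (f.isReducedCover_iff R.noIsolatedEdges R'.noIsolatedEdges).1 hf
  obtain ⟨S', q, g', hS', hqv, hg', w, hqa⟩ := KHom.exists_square g hg f hv R.noIsolatedEdges
    R'.noIsolatedEdges
  let T : KleisliGraph.{u} := ⟨S', hS'⟩
  let r' : S ⟶ T := KHom.free q
  let k : R' ⟶ T := g'
  let r : R ⟶ R' := KHom.free f
  have hr' : reducedCovers r' := (reducedCovers_free_iff (R := S) (Y := T) q).2 hqv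
  have hepi' := epi_of_reducedCovers r' hr'
  have w : g ≫ r' = r ≫ k := w
  have desc : ∀ s : Limits.PushoutCocone g r, ∃ θ : T ⟶ s.pt, r' ≫ θ = s.inl := by
    intro s
    refine KHom.exists_free_comp_eq q hqv (q.arc_surjective hqv.2 hS') s.inl fun a b e => ?_
    -- Arcs collapsed by `q` come from arcs of `R` with equal images in `R'`, where the cocone
    -- condition makes `s.inl` agree.
    rcases hqa a b e with rfl | ⟨a, b, rfl, rfl, hab⟩
    · rfl
    · have h := congrArg KHom.arc s.condition
      exact (congrFun h a).trans ((congrArg (KHom.arc s.inr) hab).trans (congrFun h b).symm)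
  choose d hd using desc
  refine ⟨T, r', k, ⟨⟨w⟩, ⟨Limits.PushoutCocone.IsColimit.mk w d hd (fun s => ?_)
    fun s m hm _ => ?_⟩⟩, hr', hg'⟩
  · rw [← cancel_epi r, ← reassoc_of% w, hd, s.condition]
  · rw [← cancel_epi r', hd, hm]

theorem cospanClasses : CospanClasses reducedCovers.{u} genericMorphisms.{u} where
  iso_left φ hφ := by
    obtain ⟨f, hf, rfl⟩ := exists_eq_free_of_isIso φ hφ
    exact (reducedCovers_free_iff f).2 hf.2.2
  iso_right {X _} φ hφ := by
    obtain ⟨f, hf, rfl⟩ := exists_eq_free_of_isIso φ hφ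
    exact (KHom.isGeneric_free_iff f X.noIsolatedEdges).2 hf
  comp_left {X _ Z} _ _ hφ hψ := by
    obtain ⟨f, hf, rfl⟩ := hφ
    obtain ⟨g, hg, rfl⟩ := hψ
    have h : reducedCovers (X := X) (Y := Z) (KHom.free (f.comp g)) := by
      rw [reducedCovers_free_iff]
      rw [Etale.isReducedCover_iff _ (KleisliGraph.noIsolatedEdges _)
        (KleisliGraph.noIsolatedEdges _)] at hf hg
      exact hg.comp hf
    rw [← KHom.free_comp_free] at h
    exact h
  comp_right {X Y Z} _ _ hφ hψ :=
    KHom.IsGeneric.comp X.noIsolatedEdges Y.noIsolatedEdges Z.noIsolatedEdges hφ hψ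
  pushout := exists_isPushout

end KleisliGraph

/-! ### The factorisation system on a category of cospans -/

section Cospans

variable {C : Type u} [Category.{v} C] {E M : MorphismProperty C}

namespace CospanClasses

theorem left_comp_left (h : CospanClasses E M) {X Y Z : C} {f : X ⟶ Y} {g : Y ⟶ Z} (hf : E f)
    (hg : E g) {h1 h2} :
    h.comp (CospanClass.mk f (𝟙 Y) hf h1) (CospanClass.mk g (𝟙 Z) hg h2) =
      CospanClass.mk (f ≫ g) (𝟙 Z) (h.comp_left _ _ hf hg) h2 := by
  refine (h.comp_mk (IsPushout.of_id_fst (f := g)) hg h2).trans ?_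
  exact CospanClass.mk_eq (Iso.refl _) (by simp) (by simp)

theorem right_comp_right (h : CospanClasses E M) {X Y Z : C} {f : Y ⟶ X} {g : Z ⟶ Y} (hf : M f)
    (hg : M g) {h1 h2} :
    h.comp (CospanClass.mk (𝟙 X) f h1 hf) (CospanClass.mk (𝟙 Y) g h2 hg) =
      CospanClass.mk (𝟙 X) (g ≫ f) h1 (h.comp_right _ _ hg hf) := by
  refine (h.comp_mk (IsPushout.of_id_snd (f := f)) h1 hf).trans ?_
  exact CospanClass.mk_eq (Iso.refl _) (by simp) (by simp)

theorem left_comp_right (h : CospanClasses E M) {X Y Z : C} {f : X ⟶ Y} {g : Z ⟶ Y} (hf : E f)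
    (hg : M g) {h1 h2} :
    h.comp (CospanClass.mk f (𝟙 Y) hf h1) (CospanClass.mk (𝟙 Y) g h2 hg) =
      CospanClass.mk f g hf hg := by
  refine (h.comp_mk (IsPushout.of_id_fst (f := 𝟙 Y)) h2 h1).trans ?_
  exact CospanClass.mk_eq (Iso.refl _) (by simp) (by simp)

theorem exists_iso_of_mk_eq {T S S' R : C} {f : T ⟶ S} {g : R ⟶ S} {f' : T ⟶ S'} {g' : R ⟶ S'}
    {hf : E f} {hg : M g} {hf' : E f'} {hg' : M g'}
    (h : CospanClass.mk f g hf hg = CospanClass.mk f' g' hf' hg') :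
    ∃ e : S ≅ S', f ≫ e.hom = f' ∧ g ≫ e.hom = g' := Quotient.exact h

/-- The legs of a cospan that is invertible in the category of cospans are invertible. -/
theorem isIso_legs (h : CospanClasses E M) (hE : ∀ {X Y : C} (f : X ⟶ Y), E f → Epi f)
    (hM : ∀ {X Y Z : C} (f : X ⟶ Y) (g : Y ⟶ Z), M f → M g → IsIso (f ≫ g) → IsIso f)
    {X Y : CospanCategory h} (e : X ≅ Y) :
    ∃ (S : C) (f : X.obj ⟶ S) (g : Y.obj ⟶ S) (hf : E f) (hg : M g),
      e.hom = CospanClass.mk f g hf hg ∧ IsIso f ∧ IsIso g := by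
  obtain ⟨c, hc⟩ := Quotient.exists_rep e.hom
  obtain ⟨d, hd⟩ := Quotient.exists_rep e.inv
  refine ⟨c.apex, c.fst, c.snd, c.fst_mem, c.snd_mem, hc.symm, ?_, ?_⟩
  · obtain ⟨P, i, j, sq, hi, hj⟩ := h.pushout c.snd d.fst c.snd_mem d.fst_mem
    have h1 : h.comp (Quotient.mk _ c) (Quotient.mk _ d) = 𝟙 X := by
      rw [hc, hd]
      exact e.hom_inv_id
    obtain ⟨t, ht, -⟩ := exists_iso_of_mk_eq ((h.compAux_eq c d sq hi hj).symm.trans h1)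
    -- The relation `hom ≫ inv = 𝟙` makes `c.fst` a split monomorphism, and it is epi by `hE`.
    have := hE _ c.fst_mem
    have : IsSplitMono c.fst := ⟨⟨⟨i ≫ t.hom, by rw [← ht, Category.assoc]⟩⟩⟩
    exact isIso_of_epi_of_isSplitMono _
  · obtain ⟨P, i, j, sq, hi, hj⟩ := h.pushout d.snd c.fst d.snd_mem c.fst_mem
    have h1 : h.comp (Quotient.mk _ d) (Quotient.mk _ c) = 𝟙 Y := by
      rw [hc, hd]
      exact e.inv_hom_id
    obtain ⟨t, -, ht⟩ := exists_iso_of_mk_eq ((h.compAux_eq d c sq hi hj).symm.trans h1)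
    -- In `inv ≫ hom = 𝟙` the second leg `c.snd ≫ j` is invertible, and both factors lie in `M`.
    refine hM c.snd j c.snd_mem hj ?_
    have : c.snd ≫ j = t.inv := by rw [← cancel_mono t.hom, ht, t.inv_hom_id]
    rw [this]
    infer_instance

/-- The second leg of an invertible cospan is invertible, so its inverse can be absorbed into the
first leg. -/
theorem leftCospans_of_iso (h : CospanClasses E M) (hE : ∀ {X Y : C} (f : X ⟶ Y), E f → Epi f)
    (hM : ∀ {X Y Z : C} (f : X ⟶ Y) (g : Y ⟶ Z), M f → M g → IsIso (f ≫ g) → IsIso f)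
    {X Y : CospanCategory h} (e : X ≅ Y) : leftCospans h e.hom := by
  obtain ⟨S, f, g, hf, hg, he, -, _⟩ := h.isIso_legs hE hM e
  exact ⟨f ≫ inv g, h.comp_left _ _ hf (h.iso_left _ inferInstance),
    he.trans (CospanClass.mk_eq (asIso g).symm (by simp) (by simp))⟩

/-- If the morphisms of the first class are epimorphisms, and if the first of two composable
morphisms of the second class is invertible as soon as their composite is, then the category of
cospans has a factorisation system. -/
theorem isFactorisationSystem (h : CospanClasses E M)
    (hE : ∀ {X Y : C} (f : X ⟶ Y), E f → Epi f)
    (hM : ∀ {X Y Z : C} (f : X ⟶ Y) (g : Y ⟶ Z), M f → M g → IsIso (f ≫ g) → IsIso f) :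
    IsFactorisationSystem (leftCospans h) (rightCospans h) where
  iso_left c _ := h.leftCospans_of_iso hE hM (asIso c)
  iso_right c _ := by
    obtain ⟨S, f, g, hf, hg, he, _, -⟩ := h.isIso_legs hE hM (asIso c)
    exact ⟨g ≫ inv f, h.comp_right _ _ hg (h.iso_right _ inferInstance),
      he.trans (CospanClass.mk_eq (asIso f).symm (by simp) (by simp))⟩
  comp_left := by
    rintro X Y Z _ _ ⟨f, hf, rfl⟩ ⟨g, hg, rfl⟩
    exact ⟨f ≫ g, h.comp_left _ _ hf hg, h.left_comp_left hf hg⟩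
  comp_right := by
    rintro X Y Z _ _ ⟨f, hf, rfl⟩ ⟨g, hg, rfl⟩
    exact ⟨g ≫ f, h.comp_right _ _ hg hf, h.right_comp_right hf hg⟩
  exists_factorisation {X Y} c := by
    obtain ⟨c, rfl⟩ := Quotient.exists_rep c
    exact ⟨⟨c.apex⟩, CospanClass.mk c.fst (𝟙 _) c.fst_mem (h.iso_right _ inferInstance),
      CospanClass.mk (𝟙 _) c.snd (h.iso_left _ inferInstance) c.snd_mem,
      ⟨_, c.fst_mem, rfl⟩, ⟨_, c.snd_mem, rfl⟩, h.left_comp_right c.fst_mem c.snd_mem⟩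
  unique_comparison := by
    rintro X Y Z Z' _ _ _ _ ⟨l, hl, rfl⟩ ⟨r, hr, rfl⟩ ⟨l', hl', rfl⟩ ⟨r', hr', rfl⟩ eq
    obtain ⟨e, h1, h2⟩ := exists_iso_of_mk_eq
      (((h.left_comp_right hl hr).symm.trans eq).trans (h.left_comp_right hl' hr'))
    have hm : ∀ {A B : C} (t : A ≅ B), E t.hom := fun t => h.iso_left _ inferInstance
    have hid : ∀ A : C, M (𝟙 A) := fun A => h.iso_right _ inferInstance
    -- Both composites are the plain cospans `l / r` and `l' / r'`, so their equality is an
    -- isomorphism `e` of apices, which becomes the comparison `e / 𝟙`.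
    let e' : Z ≅ Z' :=
      { hom := CospanClass.mk e.hom (𝟙 _) (hm e) (hid _)
        inv := CospanClass.mk e.inv (𝟙 _) (hm e.symm) (hid _)
        hom_inv_id := (h.left_comp_left (hm e) (hm e.symm)).trans
          (CospanClass.mk_eq (Iso.refl _) (by simp) (by simp))
        inv_hom_id := (h.left_comp_left (hm e.symm) (hm e)).trans
          (CospanClass.mk_eq (Iso.refl _) (by simp) (by simp)) }
    refine ⟨e', ⟨?_, ?_⟩, ?_⟩
    · exact (h.left_comp_left hl (hm e)).trans (CospanClass.mk_eq (Iso.refl _) (by simp [h1])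
        (by simp))
    · exact (h.left_comp_right (hm e) hr').trans (CospanClass.mk_eq e.symm (by simp)
        (by simp [← h2]))
    · rintro t ⟨ht, -⟩
      -- Any comparison has the form `k / 𝟙`. The identity second legs rigidify the isomorphism of
      -- cospans, leaving `l ≫ k = l ≫ e.hom`, and `l` is epi.
      obtain ⟨k, hk, hk'⟩ := h.leftCospans_of_iso hE hM t
      rw [hk'] at ht
      obtain ⟨i, hi, hi'⟩ := exists_iso_of_mk_eq ((h.left_comp_left hl hk).symm.trans ht)
      have := hE l hl
      have hi' : i.hom = 𝟙 _ := by simpa using hi'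
      rw [hi', Category.comp_id, ← h1, cancel_epi] at hi
      subst hi
      exact Iso.ext hk'

end CospanClasses

end Cospans

theorem mainTheorem6 :
    (∀ (R R' : KleisliGraph.{u}) (r : R ⟶ R'), reducedCovers r → Epi r) ∧
      ∃ h : CospanClasses reducedCovers.{u} genericMorphisms.{u},
        IsFactorisationSystem (leftCospans h) (rightCospans h) :=
  ⟨fun _ _ r hr => KleisliGraph.epi_of_reducedCovers r hr, KleisliGraph.cospanClasses,
    KleisliGraph.cospanClasses.isFactorisationSystem
      (fun f hf => KleisliGraph.epi_of_reducedCovers f hf)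
      (fun f g hf _ hi => KleisliGraph.isIso_of_genericMorphisms f g hf hi)⟩
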